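/- **Theorem 1 (Oracle inequality).** Setting. For $\beta>0$ let $\lfloor\beta\rfloor$ denote the largest integer strictly smaller than $\beta$. Let $\mathcal H^\beta_d(\mathbb R^d,Q)$ be the set of functions $g:\mathbb R^d\to\mathbb R$ whose partial derivatives of order at most $\lfloor\beta\rfloor$ exist and are continuous and which satisfy $$\sum_{|\gamma|_1<\beta}\|\partial^\gamma g\|_\infty+\sum_{|\gamma|_1=\lfloor\beta\rfloor}\sup_{x\neq y}\frac{|\partial^\gamma g(x)-\partial^\gamma g(y)|}{|x-y|_\infty^{\beta-\lfloor\beta\rfloor}}\le Q,$$ and let $\mathcal C^\beta_d([0,1]^d,Q)$ be the set of restrictions to $[0,1]^d$ of the functions $g\in\mathcal H^\beta_d(\mathbb R^d,Q)$ with $g\ge 0$, $\operatorname{supp} g\subseteq[0,1]^d$ and $\int g=1$. A kernel of order $s\in\{0,1,2,\dots\}$ is a measurable $K:\mathbb R\to\mathbb R$ with $\int K=1$, $\int u^\ell K(u)\,du=0$ for $\ell=1,\dots,s$, and $\int|u|^{s+1}|K(u)|\,du<\infty$. Let $n\ge 3$, and let $X_1,\dots,X_n,X_1',\dots,X_n'$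 be i.i.d. on $[0,1]^d$ ($d\ge 1$) with density $f_0$. Let $h_n$ satisfy $(\log n/n)^{1/d}\le h_n\le 2(\log n/n)^{1/d}$ with $1/h_n$ a positive integer, and put $$\widehat f_{\mathrm{KDE}}(x)=\frac1{nh_n^d}\sum_{\ell=1}^n\prod_{r=1}^dK\Big(\frac{X'_{\ell,r}-x_r}{h_n}\Big),\qquad Y_i=\widehat f_{\mathrm{KDE}}(X_i),\quad i=1,\dots,n.$$ A two-stage estimator $\widehat f$ with values in a class $\mathcal F$ of functions $[0,1]^d\to\mathbb R$ is a (measurable) map that assigns to the data $(X_1,Y_1),\dots,(X_n,Y_n)$ an element of $\mathcal F$. Its risk and optimization error are $$R(\widehat f,f_0)=\mathbb E\big[(\widehat f(X)-f_0(X))^2\big],\qquad \Delta_n(\widehat f,f_0)=\mathbb E\Big[\frac1n\sum_{i=1}^n(Y_i-\widehat f(X_i))^2-\inf_{f\in\mathcal F}\frac1n\sum_{i=1}^n(Y_i-f(X_i))^2\Big],$$ where $X$ has density $f_0$ and is independent of the data. Let $\mathcal N_{\mathcal F}(\delta)$ be the smallest number of sup-norm balls of radius $\delta$ with centers in $\mathcal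 F$ that cover $\mathcal F$. Statement. Let $K$ be a bounded kernel of order $\lfloor\beta\rfloor$ with support in $[-1,1]$, and let $F\ge\max\{Q,1\}$. There exist constants $C_1,C_2,C_3$ depending only on $F,K,d,Q,\beta$ such that for all $n\ge3$, all $h_n$ as above, all $f_0\in\mathcal C^\beta_d([0,1]^d,Q)$, all classes $\mathcal F$ of measurable functions with $\|f\|_\infty\le F$ for every $f\in\mathcal F$, all two-stage estimators $\widehat f$ with values in $\mathcal F$ and all $\delta>0$, $$R(\widehat f,f_0)\le C_1\frac{\log^2(n)\,\log\big(n\vee\mathcal N_{\mathcal F}(\delta)\big)}{n}+C_2\delta+C_3\Big(\frac{\log n}{n}\Big)^{2\beta/d}+6\,\Delta_n(\widehat f,f_0)+7\inf_{f\in\mathcal F}\mathbb E\big[(f(X)-f_0(X))^2\big].$$ (If $\mathcal N_{\mathcal F}(\delta)=\infty$, the right-hand side is $+\infty$.) -/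

import Mathlib

open MeasureTheory

noncomputable section

namespace TwoStage

/-- The unit cube `[0,1]^d`, with the sup metric and (as a subtype) Lebesgue measure. -/
abbrev Cube (d : ℕ) : Type := Set.Icc (0 : Fin d → ℝ) 1

/-- The largest integer strictly smaller than `β`, for `β > 0`. -/
def floorLt (β : ℝ) : ℕ := ⌈β⌉₊ - 1

/-- The partial derivative `∂_{x_i} g`. -/
def partialDeriv {d : ℕ} (i : Fin d) (g : (Fin d → ℝ) → ℝ) : (Fin d → ℝ) → ℝ :=
  fun x => lineDeriv ℝ g x (Pi.single i 1)

/-- The multi-index derivative `∂^γ g = ∂_{x_1}^{γ_1} ⋯ ∂_{x_d}^{γ_d} g`. -/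
def multiDeriv {d : ℕ} (γ : Fin d → ℕ) (g : (Fin d → ℝ) → ℝ) : (Fin d → ℝ) → ℝ :=
  (List.finRange d).foldr (fun i u => (partialDeriv i)^[γ i] u) g

/-- The `β`-Hölder norm on `ℝ^d`, with values in `[0, ∞]`: the sum of the sup norms of the
derivatives `∂^γ g` with `|γ|₁ < β` and of the Hölder seminorms of exponent `β - ⌊β⌋` (with respect
to the sup distance) of those with `|γ|₁ = ⌊β⌋`, where `⌊β⌋` is the largest integer `< β`. -/
def holderNorm {d : ℕ} (β : ℝ) (g : (Fin d → ℝ) → ℝ) : ENNReal :=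
  (∑ m ∈ Finset.range (floorLt β + 1), ∑ γ ∈ Finset.piAntidiag (Finset.univ : Finset (Fin d)) m,
      ⨆ x, ‖multiDeriv γ g x‖ₑ) +
    ∑ γ ∈ Finset.piAntidiag (Finset.univ : Finset (Fin d)) (floorLt β),
      ⨆ (x : Fin d → ℝ) (y : Fin d → ℝ) (_ : x ≠ y),
        ‖multiDeriv γ g x - multiDeriv γ g y‖ₑ / edist x y ^ (β - (floorLt β : ℝ))

/-- `𝓗_d^β(ℝ^d, Q)`: the ball of radius `Q` of `β`-Hölder functions on `ℝ^d`. -/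
def HolderBall (d : ℕ) (β Q : ℝ) : Set ((Fin d → ℝ) → ℝ) :=
  {g | ContDiff ℝ (floorLt β : ℕ) g ∧ holderNorm β g ≤ ENNReal.ofReal Q}

/-- `𝓒_d^β(Q)`: the `β`-Hölder smooth probability densities on `ℝ^d` with support in `[0,1]^d`. -/
def HolderDensity (d : ℕ) (β Q : ℝ) : Set ((Fin d → ℝ) → ℝ) :=
  {g | g ∈ HolderBall d β Q ∧ Function.support g ⊆ Set.Icc 0 1 ∧
    ∫ x in Set.Icc (0 : Fin d → ℝ) 1, g x = 1 ∧ ∀ x, 0 ≤ g x}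

/-- `𝓒_d^β([0,1]^d, Q)`: the restrictions to `[0,1]^d` of the densities in `𝓒_d^β(Q)`. -/
def HolderDensityCube (d : ℕ) (β Q : ℝ) : Set (Cube d → ℝ) :=
  {f | ∃ g ∈ HolderDensity d β Q, ∀ x : Cube d, f x = g x}

/-- A kernel of order `s`: `∫ K = 1`, `∫ u^ℓ K(u) du = 0` for `1 ≤ ℓ ≤ s`, and
`u ↦ |u|^{s+1} K(u)` is integrable. -/
structure IsKernelOfOrder (K : ℝ → ℝ) (s : ℕ) : Prop where
  measurable : Measurable K
  integrable : Integrable K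
  integral_eq_one : ∫ u, K u = 1
  moment_eq_zero : ∀ l : ℕ, 1 ≤ l → l ≤ s → ∫ u, u ^ l * K u = 0
  moment_integrable : Integrable (fun u => |u| ^ (s + 1) * K u)

/-- Admissible bandwidths for the sample size `n`. -/
structure IsBandwidth (d n : ℕ) (h : ℝ) : Prop where
  lower : (Real.log n / n) ^ (1 / (d : ℝ)) ≤ h
  upper : h ≤ 2 * (Real.log n / n) ^ (1 / (d : ℝ))
  inv_eq_natCast : ∃ m : ℕ, 0 < m ∧ h⁻¹ = m

/-- The law on `[0,1]^d` with Lebesgue density `f`. -/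
def densityLaw {d : ℕ} (f : Cube d → ℝ) : Measure (Cube d) :=
  ((volume : Measure (Fin d → ℝ)).comap (Subtype.val : Cube d → Fin d → ℝ)).withDensity
    fun x => ENNReal.ofReal (f x)

/-- The space of full data sets `(X_1,…,X_n), (X'_1,…,X'_n)`. -/
abbrev Data (d n : ℕ) : Type := (Fin n → Cube d) × (Fin n → Cube d)

/-- The law of the full data set: all `2n` observations are independent with density `f`. -/
def dataLaw {d : ℕ} (n : ℕ) (f : Cube d → ℝ) : Measure (Data d n) :=
  (Measure.pi fun _ : Fin n => densityLaw f).prod (Measure.pi fun _ : Fin n => densityLaw f)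

/-- The kernel density estimator at `x` based on the subsample `X'_1,…,X'_n`. -/
def kde {d n : ℕ} (K : ℝ → ℝ) (h : ℝ) (X' : Fin n → Cube d) (x : Cube d) : ℝ :=
  1 / (n * h ^ d) * ∑ l, ∏ r, K (((X' l : Fin d → ℝ) r - (x : Fin d → ℝ) r) / h)

/-- The regression data `(X_i, Y_i)` with `Y_i = f̂_KDE(X_i)`. -/
def regData {d n : ℕ} (K : ℝ → ℝ) (h : ℝ) (D : Data d n) : Fin n → Cube d × ℝ :=
  fun i => (D.1 i, kde K h D.2 (D.1 i))

/-- The least squares loss `(1/n) ∑ (Y_i - f(X_i))²`. -/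
def loss {d n : ℕ} (Z : Fin n → Cube d × ℝ) (f : Cube d → ℝ) : ℝ :=
  1 / n * ∑ i, ((Z i).2 - f (Z i).1) ^ 2

/-- The optimization error `Δ_n(f̂, f₀)` of `f̂` over the class `𝓕`: the expected difference between
the loss of `f̂` and the infimum of the loss over `𝓕`. As `f̂` has values in `𝓕` the difference is
nonnegative, so its expectation is written as an integral of a `[0, ∞]`-valued function, which
agrees with the usual expectation whenever the infimum is measurable. -/
def optError {d n : ℕ} (K : ℝ → ℝ) (h : ℝ) (𝓕 : Set (Cube d → ℝ))
    (fhat : (Fin n → Cube d × ℝ) → Cube d → ℝ) (f₀ : Cube d → ℝ) : ℝ :=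
  (∫⁻ D, ENNReal.ofReal (loss (regData K h D) (fhat (regData K h D)) -
    ⨅ f : 𝓕, loss (regData K h D) f.1) ∂dataLaw n f₀).toReal

/-- The risk `R(f̂, f₀) = E[(f̂(X) - f₀(X))²]`, where `X` has density `f₀` and is independent of the
data. -/
def risk {d n : ℕ} (K : ℝ → ℝ) (h : ℝ) (fhat : (Fin n → Cube d × ℝ) → Cube d → ℝ)
    (f₀ : Cube d → ℝ) : ℝ :=
  ∫ p, (fhat (regData K h p.1) p.2 - f₀ p.2) ^ 2 ∂(dataLaw n f₀).prod (densityLaw f₀)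

/-- The covering number `𝓝_𝓕(δ)`: the smallest number of sup norm balls of radius `δ` with centres
in `𝓕` that cover `𝓕` (`⊤` if there is no finite cover). -/
def supCoveringNumber {d : ℕ} (𝓕 : Set (Cube d → ℝ)) (δ : NNReal) : ℕ∞ :=
  Metric.coveringNumber (X := UniformFun (Cube d) ℝ) δ (UniformFun.toFun ⁻¹' 𝓕)

end TwoStage

end

/-! Write k̄ for the kernel estimator, an average over the second sample X', and g = f - f₀.
Expanding squares, the empirical loss of f is that of f₀ minus the empirical mean of the gain 2(k̄ -
f₀)g - g². Hence, for every fixed v in the class, the risk of the estimator is the expectation of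
three pieces: (risk + 6 × its mean gain), 6 × (its loss - the loss of v), and -6 × the mean gain of
v. The second piece is at most 6 times the optimization error. In the third, v is not random, so
only the bias b of k̄ enters, and it costs 7 ∫ (v - f₀)² + 36 b² (`integral_comparison_le`).

The first piece is the stochastic one. For a fixed f its exponential moment at scale n/L, with L
free of n, is at most 1 once 12 b² is subtracted (`exp_moment_sample_le`). Integrating over X with
X' frozen produces -∫ g² from the quadratic part of the gain; the gain is divisible by g, so its
second moment is O(∫ g²) as soon as k̄ is bounded. What is left is a sum over X' of φ(X'_l), where
φ(y) = ∫ k(y,x) g(x); a Schur test gives ∫ φ² = O(∫ g²) although k itself can be of size h^{-d}. The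
negative quadratic term pays for both fluctuations. So k̄ - f₀ need not be small, only bounded. A
log-sum-exp bound over a δ-net then yields L (log N + 1) / n (`integral_risk_add_gain_le`).

Boundedness of k̄ holds off an event of probability O(n^{-2}): since n h^d ≥ log n, it is enough
that no box of side of order h holds more than O(log n) points (`abs_sampleMean_prodKernel_le`). The
bias is O(h^β) by Taylor expansion along coordinate lines and the vanishing moments of K
(`abs_integral_prod_kernel_mul_sub_le`). This argument gives the stochastic term without the factor
log² n, which is inserted only at the end. -/

namespace TwoStage

/-! ### Sample means, exponential moments and the Schur test -/

section Abstract

variable {Ω : Type*} [MeasurableSpace Ω]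

/-- The empirical mean of `ψ` over a sample. -/
@[irreducible] noncomputable def sampleMean {n : ℕ} (ψ : Ω → ℝ) (X : Fin n → Ω) : ℝ :=
  1 / n * ∑ i, ψ (X i)

theorem integrable_of_abs_le {α : Type*} [MeasurableSpace α] {μ : Measure α} [IsFiniteMeasure μ]
    {f : α → ℝ} (hf : Measurable f) {C : ℝ} (hC : ∀ x, |f x| ≤ C) : Integrable f μ :=
  Integrable.of_bound hf.aestronglyMeasurable C (ae_of_all _ hC)

theorem abs_sampleMean_le {Ω : Type*} {n : ℕ} {ψ : Ω → ℝ} {c : ℝ} (hc0 : 0 ≤ c)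
    (hc : ∀ x, |ψ x| ≤ c)
    (X : Fin n → Ω) : |sampleMean ψ X| ≤ c := by
  unfold sampleMean
  rcases Nat.eq_zero_or_pos n with rfl | hn
  · simpa using hc0
  have hn' : (0 : ℝ) < n := by exact_mod_cast hn
  rw [abs_mul, abs_of_nonneg (by positivity : (0 : ℝ) ≤ 1 / n)]
  calc 1 / (n : ℝ) * |∑ i, ψ (X i)| ≤ 1 / n * ∑ _i : Fin n, c := by
        gcongr
        exact (Finset.abs_sum_le_sum_abs _ _).trans (Finset.sum_le_sum fun i _ => hc _)
    _ = c := by simp; field_simp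

theorem measurable_sampleMean {n : ℕ} {α : Type*} [MeasurableSpace α] {ψ : α → Ω → ℝ}
    (hψ : Measurable (Function.uncurry ψ)) {X : α → Fin n → Ω} (hX : Measurable X) :
    Measurable fun a => sampleMean (ψ a) (X a) := by
  unfold sampleMean
  refine measurable_const.mul (Finset.measurable_sum _ fun i _ => ?_)
  exact hψ.comp (measurable_id.prodMk ((measurable_pi_apply i).comp hX))

/-- On |z| ≤ 1 one has e^z ≤ 1 + z + z²; integrate and use 1 + w ≤ e^w. The raw second moment
suffices in place of the variance, because later it is always compared with ∫ g². -/
theorem integral_exp_le (μ : Measure Ω) [IsProbabilityMeasure μ] {ψ : Ω → ℝ} (hψ : Measurable ψ)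
    {t : ℝ} (hb : ∀ x, |t * ψ x| ≤ 1) (hi : Integrable ψ μ)
    (hi2 : Integrable (fun x => ψ x ^ 2) μ) :
    ∫ x, Real.exp (t * ψ x) ∂μ ≤ Real.exp (t * ∫ x, ψ x ∂μ + t ^ 2 * ∫ x, ψ x ^ 2 ∂μ) := by
  have h1 : ∀ x, Real.exp (t * ψ x) ≤ 1 + (t * ψ x + t ^ 2 * ψ x ^ 2) := fun x => by
    have := (abs_le.1 (Real.abs_exp_sub_one_sub_id_le (hb x))).2
    rw [mul_pow] at this
    linarith
  have hint : Integrable (fun x => t * ψ x + t ^ 2 * ψ x ^ 2) μ :=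
    (hi.const_mul t).add (hi2.const_mul (t ^ 2))
  have hexp : Integrable (fun x => Real.exp (t * ψ x)) μ := by
    refine integrable_of_abs_le (by fun_prop) (C := Real.exp 1) fun x => ?_
    rw [abs_of_nonneg (Real.exp_pos _).le]
    exact Real.exp_le_exp.2 (le_of_abs_le (hb x))
  calc ∫ x, Real.exp (t * ψ x) ∂μ ≤ ∫ x, (1 + (t * ψ x + t ^ 2 * ψ x ^ 2)) ∂μ :=
        integral_mono hexp ((integrable_const _).add hint) h1
    _ = (t * ∫ x, ψ x ∂μ + t ^ 2 * ∫ x, ψ x ^ 2 ∂μ) + 1 := by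
        rw [integral_add (integrable_const _) hint,
          integral_add (hi.const_mul t) (hi2.const_mul (t ^ 2)), integral_const_mul,
          integral_const_mul]
        simp
        ring
    _ ≤ _ := Real.add_one_le_exp _

theorem integral_exp_sum_le (μ : Measure Ω) [IsProbabilityMeasure μ] {ψ : Ω → ℝ}
    (hψ : Measurable ψ) {c t : ℝ} (hc : ∀ x, |ψ x| ≤ c) (htc : |t| * c ≤ 1) (n : ℕ) :
    ∫ X : Fin n → Ω, Real.exp (t * ∑ i, ψ (X i)) ∂Measure.pi (fun _ => μ) ≤
      Real.exp (n * (t * ∫ x, ψ x ∂μ + t ^ 2 * ∫ x, ψ x ^ 2 ∂μ)) := by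
  have h1 : ∀ X : Fin n → Ω, Real.exp (t * ∑ i, ψ (X i)) = ∏ i, Real.exp (t * ψ (X i)) :=
    fun X => by rw [Finset.mul_sum, Real.exp_sum]
  simp_rw [h1]
  rw [integral_fintype_prod_eq_pow (fun x => Real.exp (t * ψ x)), Fintype.card_fin,
    Real.exp_nat_mul]
  refine pow_le_pow_left₀ (integral_nonneg fun x => (Real.exp_pos _).le) ?_ _
  refine integral_exp_le μ hψ (fun x => ?_) (integrable_of_abs_le hψ hc)
    (integrable_of_abs_le (hψ.pow_const 2) (C := c ^ 2) fun x => ?_)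
  · rw [abs_mul]
    exact (mul_le_mul_of_nonneg_left (hc x) (abs_nonneg t)).trans htc
  · rw [abs_pow]
    exact pow_le_pow_left₀ (abs_nonneg _) (hc x) 2

/-- The expectation of a double average over two independent samples. -/
theorem integral_sampleMean_sampleMean (μ : Measure Ω) [IsProbabilityMeasure μ] {n : ℕ}
    (hn : 0 < n) {ξ : Ω → Ω → ℝ} (hξ : Measurable (Function.uncurry ξ)) {c : ℝ}
    (hc : ∀ x y, |ξ x y| ≤ c) :
    ∫ D : (Fin n → Ω) × (Fin n → Ω), sampleMean (fun x => sampleMean (ξ x) D.2) D.1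
      ∂(Measure.pi fun _ => μ).prod (Measure.pi fun _ => μ) = ∫ x, ∫ y, ξ x y ∂μ ∂μ := by
  have hint : Integrable (Function.uncurry ξ) (μ.prod μ) :=
    integrable_of_abs_le hξ fun p => hc p.1 p.2
  have hmp : ∀ i l : Fin n, MeasurePreserving (fun D : (Fin n → Ω) × (Fin n → Ω) => (D.1 i, D.2 l))
      ((Measure.pi fun _ => μ).prod (Measure.pi fun _ => μ)) (μ.prod μ) := fun i l =>
    (measurePreserving_eval (fun _ => μ) i).prod (measurePreserving_eval (fun _ => μ) l)
  have hI : ∀ i l : Fin n, Integrable (fun D : (Fin n → Ω) × (Fin n → Ω) => ξ (D.1 i) (D.2 l))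
      ((Measure.pi fun _ => μ).prod (Measure.pi fun _ => μ)) := fun i l =>
    (hmp i l).integrable_comp_of_integrable hint
  have hE : ∀ i l : Fin n, ∫ D : (Fin n → Ω) × (Fin n → Ω), ξ (D.1 i) (D.2 l)
      ∂(Measure.pi fun _ => μ).prod (Measure.pi fun _ => μ) = ∫ x, ∫ y, ξ x y ∂μ ∂μ := fun i l => by
    have h2 := integral_prod _ hint
    simp only [Function.uncurry] at h2
    rw [← h2, ← (hmp i l).map_eq, integral_map (hmp i l).measurable.aemeasurable]
    exact hξ.aestronglyMeasurable
  have hn' : (n : ℝ) ≠ 0 := by exact_mod_cast hn.ne'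
  unfold sampleMean
  rw [integral_const_mul, integral_finsetSum _ fun i _ =>
    ((integrable_finsetSum _ fun l _ => hI i l).const_mul _)]
  simp_rw [integral_const_mul]
  simp_rw [integral_finsetSum _ fun l _ => hI _ l, hE]
  simp
  field_simp

/-- Boundedness of the `L²` norm of an averaging operator (Schur test). -/
theorem integral_sq_integral_mul_le (μ : Measure Ω) [IsProbabilityMeasure μ] {k : Ω → Ω → ℝ}
    (hk : Measurable (Function.uncurry k)) {κ A : ℝ} (hκ : ∀ y x, |k y x| ≤ κ) (hA : 0 < A)
    (hA1 : ∀ x, ∫ y, |k y x| ∂μ ≤ A) (hA2 : ∀ y, ∫ x, |k y x| ∂μ ≤ A) {g : Ω → ℝ}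
    (hg : Measurable g) {c : ℝ} (hc : ∀ x, |g x| ≤ c) :
    ∫ y, (∫ x, k y x * g x ∂μ) ^ 2 ∂μ ≤ A ^ 2 * ∫ x, g x ^ 2 ∂μ := by
  have hky : ∀ y, Measurable (k y) := fun y => hk.comp measurable_prodMk_left
  have hgx2 : ∀ x, |g x ^ 2| ≤ c ^ 2 := fun x => by
    rw [abs_pow]
    exact pow_le_pow_left₀ (abs_nonneg _) (hc x) 2
  have hprod : ∀ y x, |(|k y x| * g x ^ 2)| ≤ κ * c ^ 2 := fun y x => by
    rw [abs_mul, abs_abs]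
    exact mul_le_mul (hκ y x) (hgx2 x) (abs_nonneg _) ((abs_nonneg _).trans (hκ y x))
  have hprod1 : ∀ y x, |k y x * g x| ≤ κ * c := fun y x => by
    rw [abs_mul]
    exact mul_le_mul (hκ y x) (hc x) (abs_nonneg _) ((abs_nonneg _).trans (hκ y x))
  have hm2 : Measurable (Function.uncurry fun y x => |k y x| * g x ^ 2) := by
    have : Measurable fun p : Ω × Ω => |Function.uncurry k p| * g p.2 ^ 2 :=
      (measurable_norm.comp hk).mul ((hg.comp measurable_snd).pow_const 2)
    exact this
  have hm1 : Measurable (Function.uncurry fun y x => k y x * g x) :=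
    hk.mul (hg.comp measurable_snd)
  have hi2 : Integrable (Function.uncurry fun y x => |k y x| * g x ^ 2) (μ.prod μ) :=
    integrable_of_abs_le hm2 fun p => hprod p.1 p.2
  have hphi : Measurable fun y => ∫ x, k y x * g x ∂μ :=
    (StronglyMeasurable.integral_prod_right hm1.stronglyMeasurable).measurable
  have hphib : ∀ y, |∫ x, k y x * g x ∂μ| ≤ κ * c := fun y => by
    refine (norm_integral_le_of_norm_le_const (μ := μ) (f := fun x => k y x * g x)
      (ae_of_all _ (hprod1 y))).trans ?_
    simp
  have hpt : ∀ y, (∫ x, k y x * g x ∂μ) ^ 2 ≤ A * ∫ x, |k y x| * g x ^ 2 ∂μ := fun y => by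
    set m := ∫ x, k y x * g x ∂μ with hm
    have hi1 : Integrable (fun x => k y x * g x) μ :=
      integrable_of_abs_le ((hky y).mul hg) (hprod1 y)
    have hik : Integrable (fun x => |k y x|) μ :=
      integrable_of_abs_le (measurable_norm.comp (hky y)) fun x =>
        (abs_abs (k y x)).le.trans (hκ y x)
    have hi3 : Integrable (fun x => |k y x| * g x ^ 2) μ :=
      integrable_of_abs_le ((measurable_norm.comp (hky y)).mul (hg.pow_const 2)) (hprod y)
    -- Cauchy–Schwarz with weight |k y ·|, in the form 2(m/A)g ≤ (m/A)² + g². Since |k y ·| has mass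
    -- at most A, the choice m/A is the one that gives m² ≤ A ∫ |k| g².
    have h1 : ∫ x, 2 * (m / A) * (k y x * g x) ∂μ ≤
        ∫ x, ((m / A) ^ 2 * |k y x| + |k y x| * g x ^ 2) ∂μ := by
      refine integral_mono (hi1.const_mul _) ((hik.const_mul _).add hi3) fun x => ?_
      have hle : 2 * (m / A) * g x * k y x ≤ |2 * (m / A) * g x| * |k y x| := by
        rw [← abs_mul]; exact le_abs_self _
      have h2 : |2 * (m / A) * g x| ≤ (m / A) ^ 2 + g x ^ 2 := by
        rw [abs_le]; constructor <;> nlinarith [sq_nonneg (m / A - g x), sq_nonneg (m / A + g x)]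
      nlinarith [abs_nonneg (k y x), mul_le_mul_of_nonneg_right h2 (abs_nonneg (k y x))]
    rw [integral_const_mul, integral_add (hik.const_mul _) hi3, integral_const_mul, ← hm] at h1
    have h2 : (m / A) ^ 2 * ∫ x, |k y x| ∂μ ≤ (m / A) ^ 2 * A :=
      mul_le_mul_of_nonneg_left (hA2 y) (sq_nonneg _)
    have h3 : m ^ 2 / A ≤ ∫ x, |k y x| * g x ^ 2 ∂μ := by
      have e1 : 2 * (m / A) * m = 2 * (m ^ 2 / A) := by ring
      have e2 : (m / A) ^ 2 * A = m ^ 2 / A := by field_simp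
      linarith
    rw [div_le_iff₀ hA] at h3
    linarith
  calc ∫ y, (∫ x, k y x * g x ∂μ) ^ 2 ∂μ ≤ ∫ y, A * ∫ x, |k y x| * g x ^ 2 ∂μ ∂μ := by
        refine integral_mono (integrable_of_abs_le (hphi.pow_const 2) (C := (κ * c) ^ 2)
            fun y => ?_)
          (hi2.integral_prod_left.const_mul A) hpt
        rw [abs_pow]
        exact pow_le_pow_left₀ (abs_nonneg _) (hphib y) 2
    _ = A * ∫ x, ∫ y, |k y x| * g x ^ 2 ∂μ ∂μ := by
        rw [integral_const_mul, integral_integral_swap hi2]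
    _ ≤ A * ∫ x, A * g x ^ 2 ∂μ := by
        refine mul_le_mul_of_nonneg_left ?_ hA.le
        refine integral_mono hi2.integral_prod_right
          ((integrable_of_abs_le (hg.pow_const 2) hgx2).const_mul A) fun x => ?_
        simp only
        rw [integral_mul_const]
        exact mul_le_mul_of_nonneg_right (hA1 x) (sq_nonneg _)
    _ = A ^ 2 * ∫ x, g x ^ 2 ∂μ := by rw [integral_const_mul]; ring

theorem sq_le_sq_of_abs_le {a c : ℝ} (h : |a| ≤ c) : a ^ 2 ≤ c ^ 2 :=
  sq_le_sq.2 (h.trans (le_abs_self c))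

theorem abs_sq_le_sq_of_abs_le {a c : ℝ} (h : |a| ≤ c) : |a ^ 2| ≤ c ^ 2 := by
  rw [abs_of_nonneg (sq_nonneg _)]; exact sq_le_sq_of_abs_le h

theorem integrable_sq_of_abs_le {μ : Measure Ω} [IsFiniteMeasure μ] {g : Ω → ℝ} (hg : Measurable g)
    {c : ℝ} (hc : ∀ x, |g x| ≤ c) : Integrable (fun x => g x ^ 2) μ :=
  integrable_of_abs_le (hg.pow_const 2) fun x => abs_sq_le_sq_of_abs_le (hc x)

/-! ### The gain of a fixed deviation and its exponential moment -/

/-- The gain `2 (k̄(x) - f₀(x)) g(x) - g(x)²` of the deviation `g`, where `k̄` is the kernel average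
over the sample. -/
@[irreducible] noncomputable def gain {n : ℕ} (k : Ω → Ω → ℝ) (f₀ g : Ω → ℝ)
    (X' : Fin n → Ω) (x : Ω) : ℝ :=
  2 * (sampleMean (fun y => k y x) X' - f₀ x) * g x - g x ^ 2

theorem measurable_kernelMean {n : ℕ} {k : Ω → Ω → ℝ} (hk : Measurable (Function.uncurry k)) :
    Measurable fun p : (Fin n → Ω) × Ω => sampleMean (fun y => k y p.2) p.1 := by
  refine measurable_sampleMean (ψ := fun (p : (Fin n → Ω) × Ω) y => k y p.2)
    (X := fun p : (Fin n → Ω) × Ω => p.1) ?_ measurable_fst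
  exact hk.comp (measurable_snd.prodMk (measurable_snd.comp measurable_fst))

theorem measurable_gain {n : ℕ} {k : Ω → Ω → ℝ} (hk : Measurable (Function.uncurry k))
    {f₀ g : Ω → ℝ} (hf₀ : Measurable f₀) (hg : Measurable g) :
    Measurable fun p : (Fin n → Ω) × Ω => gain k f₀ g p.1 p.2 := by
  unfold gain
  refine Measurable.sub ?_ ((hg.comp measurable_snd).pow_const 2)
  exact (((measurable_kernelMean hk).sub (hf₀.comp measurable_snd)).const_mul 2).mul
    (hg.comp measurable_snd)

theorem measurable_gain_comp {α : Type*} [MeasurableSpace α] {n : ℕ} {k : Ω → Ω → ℝ}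
    (hk : Measurable (Function.uncurry k)) {f₀ g : Ω → ℝ} (hf₀ : Measurable f₀)
    (hg : Measurable g) {X' : α → Fin n → Ω} (hX' : Measurable X') :
    Measurable (Function.uncurry fun a x => gain k f₀ g (X' a) x) :=
  (measurable_gain hk hf₀ hg).comp ((hX'.comp measurable_fst).prodMk measurable_snd)

theorem measurable_gain_right {n : ℕ} {k : Ω → Ω → ℝ} (hk : Measurable (Function.uncurry k))
    {f₀ g : Ω → ℝ} (hf₀ : Measurable f₀) (hg : Measurable g) (X' : Fin n → Ω) :
    Measurable (gain k f₀ g X') := by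
  have h : Measurable fun x : Ω => (X', x) := measurable_prodMk_left
  exact (measurable_gain hk hf₀ hg).comp h

theorem gain_eq_mul {Ω : Type*} {n : ℕ} (k : Ω → Ω → ℝ) (f₀ g : Ω → ℝ) (X' : Fin n → Ω) (x : Ω) :
    gain k f₀ g X' x = (2 * (sampleMean (fun y => k y x) X' - f₀ x) - g x) * g x := by
  unfold gain; ring

theorem abs_gain_factor_le {Ω : Type*} {n : ℕ} {k : Ω → Ω → ℝ} {f₀ g : Ω → ℝ} {F c : ℝ}
    (hf₀F : ∀ x, |f₀ x| ≤ F) (hgF : ∀ x, |g x| ≤ 2 * F) {X' : Fin n → Ω} {x : Ω}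
    (h : |sampleMean (fun y => k y x) X'| ≤ c) :
    |2 * (sampleMean (fun y => k y x) X' - f₀ x) - g x| ≤ 2 * c + 4 * F := by
  have h1 := abs_le.1 h
  have h2 := abs_le.1 (hf₀F x)
  have h3 := abs_le.1 (hgF x)
  rw [abs_le]
  constructor <;> linarith [h1.1, h1.2, h2.1, h2.2, h3.1, h3.2]

theorem abs_gain_le {Ω : Type*} {n : ℕ} {k : Ω → Ω → ℝ} {f₀ g : Ω → ℝ} {F c : ℝ}
    (hf₀F : ∀ x, |f₀ x| ≤ F) (hgF : ∀ x, |g x| ≤ 2 * F) {X' : Fin n → Ω} {x : Ω}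
    (h : |sampleMean (fun y => k y x) X'| ≤ c) :
    |gain k f₀ g X' x| ≤ (2 * c + 4 * F) * (2 * F) := by
  have := abs_gain_factor_le hf₀F hgF h
  rw [gain_eq_mul, abs_mul]
  exact mul_le_mul this (hgF x) (abs_nonneg _) ((abs_nonneg _).trans this)

theorem integrable_kernel_mul {μ : Measure Ω} [IsProbabilityMeasure μ] {k : Ω → Ω → ℝ}
    (hk : Measurable (Function.uncurry k)) {κ c : ℝ} (hκ : ∀ y x, |k y x| ≤ κ) {g : Ω → ℝ}
    (hg : Measurable g) (hc : ∀ x, |g x| ≤ c) (y : Ω) : Integrable (fun x => k y x * g x) μ := by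
  refine integrable_of_abs_le ((hk.comp measurable_prodMk_left).mul hg) (C := κ * c) fun x => ?_
  rw [abs_mul]
  exact mul_le_mul (hκ y x) (hc x) (abs_nonneg _) ((abs_nonneg _).trans (hκ y x))

/-- The gain is affine in k̄, so its mean given X' is again an average over X'; this makes the
second integration, over X', another exponential moment of an i.i.d. sum. -/
theorem integral_gain {μ : Measure Ω} [IsProbabilityMeasure μ] {n : ℕ} {k : Ω → Ω → ℝ}
    (hk : Measurable (Function.uncurry k)) {κ F c : ℝ} (hκ : ∀ y x, |k y x| ≤ κ)
    {f₀ g : Ω → ℝ} (hf₀ : Measurable f₀) (hf₀F : ∀ x, |f₀ x| ≤ F) (hg : Measurable g)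
    (hc : ∀ x, |g x| ≤ c) (X' : Fin n → Ω) :
    ∫ x, gain k f₀ g X' x ∂μ = 2 * (1 / n * ∑ l, ∫ x, k (X' l) x * g x ∂μ)
      - 2 * ∫ x, f₀ x * g x ∂μ - ∫ x, g x ^ 2 ∂μ := by
  have e : ∀ x, gain k f₀ g X' x =
      2 * (1 / n * ∑ l, k (X' l) x * g x) - 2 * (f₀ x * g x) - g x ^ 2 := fun x => by
    simp only [gain, sampleMean]
    rw [← Finset.sum_mul]; ring
  simp_rw [e]
  have hsi : Integrable (fun x => ∑ l, k (X' l) x * g x) μ :=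
    integrable_finsetSum _ fun l _ => integrable_kernel_mul hk hκ hg hc (X' l)
  have hf₀gi : Integrable (fun x => f₀ x * g x) μ := by
    refine integrable_of_abs_le (hf₀.mul hg) (C := F * c) fun x => ?_
    rw [abs_mul]
    exact mul_le_mul (hf₀F x) (hc x) (abs_nonneg _) ((abs_nonneg _).trans (hf₀F x))
  have h1 : Integrable (fun x => 2 * (1 / (n : ℝ) * ∑ l, k (X' l) x * g x)) μ :=
    (hsi.const_mul _).const_mul _
  have h2 : Integrable (fun x => 2 * (f₀ x * g x)) μ := hf₀gi.const_mul _
  have h3 : Integrable (fun x =>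
      2 * (1 / (n : ℝ) * ∑ l, k (X' l) x * g x) - 2 * (f₀ x * g x)) μ := h1.sub h2
  rw [integral_sub h3 (integrable_sq_of_abs_le hg hc), integral_sub h1 h2, integral_const_mul,
    integral_const_mul, integral_const_mul,
    integral_finsetSum _ fun l _ => integrable_kernel_mul hk hκ hg hc (X' l)]

/-- Bernstein condition: the gain is g times a factor bounded by 2B + 4F, so its second moment is
controlled by the same ∫ g² that appears with a negative sign in its mean. -/
theorem integral_sq_gain_le {μ : Measure Ω} [IsProbabilityMeasure μ] {n : ℕ} {k : Ω → Ω → ℝ}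
    (hk : Measurable (Function.uncurry k)) {F B : ℝ}
    {f₀ g : Ω → ℝ} (hf₀ : Measurable f₀) (hf₀F : ∀ x, |f₀ x| ≤ F) (hg : Measurable g)
    (hgF : ∀ x, |g x| ≤ 2 * F) {X' : Fin n → Ω}
    (hB : ∀ x, |sampleMean (fun y => k y x) X'| ≤ B) :
    ∫ x, gain k f₀ g X' x ^ 2 ∂μ ≤ (2 * B + 4 * F) ^ 2 * ∫ x, g x ^ 2 ∂μ := by
  rw [← integral_const_mul]
  refine integral_mono (integrable_sq_of_abs_le (measurable_gain_right hk hf₀ hg X')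
    fun x => abs_gain_le hf₀F hgF (hB x)) ((integrable_sq_of_abs_le hg hgF).const_mul _) fun x => ?_
  simp only [gain_eq_mul, mul_pow]
  exact mul_le_mul_of_nonneg_right (sq_le_sq_of_abs_le (abs_gain_factor_le hf₀F hgF (hB x)))
    (sq_nonneg _)

/-- Integration over the first sample, at t = 6/L. The coefficient -5 is 1 - 6, from the risk and
from the quadratic part of the gain. All dependence on X' is isolated in the last exponential. -/
theorem integral_exp_sampleMean_gain_le {μ : Measure Ω} [IsProbabilityMeasure μ] {n : ℕ}
    (hn : 0 < n) {k : Ω → Ω → ℝ} (hk : Measurable (Function.uncurry k)) {κ B F b L : ℝ}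
    (hκ : ∀ y x, |k y x| ≤ κ)
    {f₀ g : Ω → ℝ} (hf₀ : Measurable f₀) (hf₀F : ∀ x, |f₀ x| ≤ F) (hg : Measurable g)
    (hgF : ∀ x, |g x| ≤ 2 * F) {X' : Fin n → Ω}
    (hB : ∀ x, |sampleMean (fun y => k y x) X'| ≤ B)
    (hL0 : 0 < L) (hL1 : 12 * (2 * B + 4 * F) * F ≤ L) :
    ∫ X : Fin n → Ω, Real.exp (n / L * (∫ x, g x ^ 2 ∂μ +
        6 * sampleMean (gain k f₀ g X') X - 12 * b ^ 2)) ∂Measure.pi (fun _ => μ) ≤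
      Real.exp (n / L * (-5 * ∫ x, g x ^ 2 ∂μ - 12 * b ^ 2 - 12 * ∫ x, f₀ x * g x ∂μ +
        36 / L * ((2 * B + 4 * F) ^ 2 * ∫ x, g x ^ 2 ∂μ))) *
      Real.exp (12 / L * ∑ l, ∫ x, k (X' l) x * g x ∂μ) := by
  have hn0 : (0 : ℝ) < n := by exact_mod_cast hn
  have hrew : ∀ X : Fin n → Ω, Real.exp (n / L * (∫ x, g x ^ 2 ∂μ +
        6 * sampleMean (gain k f₀ g X') X - 12 * b ^ 2)) =
      Real.exp (n / L * (∫ x, g x ^ 2 ∂μ - 12 * b ^ 2)) *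
        Real.exp (6 / L * ∑ i, gain k f₀ g X' (X i)) := fun X => by
    rw [← Real.exp_add]
    simp only [sampleMean]; congr 1; field_simp; ring
  simp_rw [hrew]
  rw [integral_const_mul]
  refine (mul_le_mul_of_nonneg_left (integral_exp_sum_le μ
    (measurable_gain_right hk hf₀ hg X') (fun x => abs_gain_le hf₀F hgF (hB x)) ?_ n)
    (Real.exp_pos _).le).trans ?_
  · rw [abs_of_pos (by positivity), div_mul_eq_mul_div, div_le_one hL0]
    linarith
  · rw [← Real.exp_add, ← Real.exp_add, Real.exp_le_exp, integral_gain hk hκ hf₀ hf₀F hg hgF]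
    have h1 := mul_le_mul_of_nonneg_left (integral_sq_gain_le (μ := μ) hk hf₀ hf₀F hg hgF hB)
      (sq_nonneg (6 / L))
    have h2 := mul_le_mul_of_nonneg_left h1 hn0.le
    rw [mul_add]
    refine (add_le_add_right (add_le_add_right h2 _) _).trans (le_of_eq ?_)
    field_simp
    ring

/-- After swapping integrals the left side is ∫ bias · g, and bias · g ≤ bias² + g²/4. Multiplied by
12 this is 12 b² + 3 ∫ g², which cancels the subtracted 12 b² and leaves -2 of the -5 available. -/
theorem integral_integral_kernel_mul_sub_le {μ : Measure Ω} [IsProbabilityMeasure μ]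
    {k : Ω → Ω → ℝ} (hk : Measurable (Function.uncurry k)) {κ F c b : ℝ}
    (hκ : ∀ y x, |k y x| ≤ κ) {f₀ g : Ω → ℝ} (hf₀ : Measurable f₀) (hf₀F : ∀ x, |f₀ x| ≤ F)
    (hg : Measurable g) (hc : ∀ x, |g x| ≤ c)
    (hb : ∀ x, |∫ y, k y x ∂μ - f₀ x| ≤ b) :
    ∫ y, ∫ x, k y x * g x ∂μ ∂μ - ∫ x, f₀ x * g x ∂μ ≤ b ^ 2 + (∫ x, g x ^ 2 ∂μ) / 4 := by
  have hg2i : Integrable (fun x => g x ^ 2) μ := integrable_sq_of_abs_le hg hc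
  have hm1 : Measurable (Function.uncurry fun y x => k y x * g x) := hk.mul (hg.comp measurable_snd)
  have hf₀gi : Integrable (fun x => f₀ x * g x) μ := by
    refine integrable_of_abs_le (hf₀.mul hg) (C := F * c) fun x => ?_
    rw [abs_mul]
    exact mul_le_mul (hf₀F x) (hc x) (abs_nonneg _) ((abs_nonneg _).trans (hf₀F x))
  have hi : Integrable (Function.uncurry fun y x => k y x * g x) (μ.prod μ) := by
    refine integrable_of_abs_le hm1 (C := κ * c) fun p => ?_
    simp only [Function.uncurry, abs_mul]
    exact mul_le_mul (hκ _ _) (hc _) (abs_nonneg _) ((abs_nonneg _).trans (hκ p.1 p.2))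
  have h2 : Integrable (fun x => (∫ y, k y x ∂μ) * g x) μ := by
    have := hi.integral_prod_right
    simpa only [Function.uncurry, integral_mul_const] using this
  rw [integral_integral_swap hi]
  simp_rw [integral_mul_const]
  rw [← integral_sub h2 hf₀gi]
  calc ∫ x, ((∫ y, k y x ∂μ) * g x - f₀ x * g x) ∂μ ≤ ∫ x, (b ^ 2 + g x ^ 2 / 4) ∂μ := by
        refine integral_mono (h2.sub hf₀gi) ((integrable_const _).add (hg2i.div_const 4))
          fun x => ?_
        have h3 := sq_le_sq_of_abs_le (hb x)
        simp only [← sub_mul]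
        nlinarith [sq_nonneg ((∫ y, k y x ∂μ - f₀ x) - g x / 2)]
    _ = b ^ 2 + (∫ x, g x ^ 2 ∂μ) / 4 := by
        rw [integral_add (integrable_const _) (hg2i.div_const 4), integral_div]
        simp

theorem integrable_indicator_exp_gain {μ : Measure Ω} [IsProbabilityMeasure μ] {n : ℕ}
    {k : Ω → Ω → ℝ} (hk : Measurable (Function.uncurry k)) {κ F b s q : ℝ}
    (hκ : ∀ y x, |k y x| ≤ κ)
    {f₀ g : Ω → ℝ} (hf₀ : Measurable f₀) (hf₀F : ∀ x, |f₀ x| ≤ F) (hg : Measurable g)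
    (hgF : ∀ x, |g x| ≤ 2 * F) {G : Set (Fin n → Ω)} (hG : MeasurableSet G) (hs : 0 ≤ s) :
    Integrable ((Prod.snd ⁻¹' G).indicator (fun D : (Fin n → Ω) × (Fin n → Ω) =>
      Real.exp (s * (q + 6 * sampleMean (gain k f₀ g D.2) D.1 - 12 * b ^ 2))))
      ((Measure.pi fun _ => μ).prod (Measure.pi fun _ => μ)) := by
  obtain ⟨x₀⟩ : Nonempty Ω := nonempty_of_isProbabilityMeasure μ
  have hκ0 : 0 ≤ κ := (abs_nonneg _).trans (hκ x₀ x₀)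
  have hF0 : 0 ≤ F := (abs_nonneg _).trans (hf₀F x₀)
  have hmeas : Measurable fun D : (Fin n → Ω) × (Fin n → Ω) =>
      Real.exp (s * (q + 6 * sampleMean (gain k f₀ g D.2) D.1 - 12 * b ^ 2)) := by
    refine Real.measurable_exp.comp (measurable_const.mul ((measurable_const.add
      (measurable_const.mul ?_)).sub measurable_const))
    refine measurable_sampleMean (ψ := fun D : (Fin n → Ω) × (Fin n → Ω) => gain k f₀ g D.2) ?_
      measurable_fst
    exact measurable_gain_comp hk hf₀ hg measurable_snd
  refine Integrable.indicator (integrable_of_abs_le hmeas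
    (C := Real.exp (s * (q + 6 * ((2 * κ + 4 * F) * (2 * F))))) fun D => ?_) (measurable_snd hG)
  rw [abs_of_pos (Real.exp_pos _), Real.exp_le_exp]
  refine mul_le_mul_of_nonneg_left ?_ hs
  have h1 := le_of_abs_le (abs_sampleMean_le (by positivity) (fun x => abs_gain_le hf₀F hgF
    (abs_sampleMean_le hκ0 (fun y => hκ y x) D.2)) D.1)
  nlinarith [sq_nonneg b]

/-- Two successive exponential bounds, over X given X' and then over X' with φ(y) = ∫ k(y,x) g(x).
The set G is needed only in the first, where k̄ must be bounded by B; after that step the indicator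
is dropped. `hL1` and `hL2` keep the two exponents in the range |z| ≤ 1. -/
theorem exp_moment_sample_le {μ : Measure Ω} [IsProbabilityMeasure μ] {n : ℕ} (hn : 0 < n)
    {k : Ω → Ω → ℝ} (hk : Measurable (Function.uncurry k)) {κ A B F b L : ℝ}
    (hκ : ∀ y x, |k y x| ≤ κ) (hA : 0 < A)
    (hA1 : ∀ x, ∫ y, |k y x| ∂μ ≤ A) (hA2 : ∀ y, ∫ x, |k y x| ∂μ ≤ A)
    {f₀ g : Ω → ℝ} (hf₀ : Measurable f₀) (hf₀F : ∀ x, |f₀ x| ≤ F) (hg : Measurable g)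
    (hgF : ∀ x, |g x| ≤ 2 * F)
    (hb : ∀ x, |∫ y, k y x ∂μ - f₀ x| ≤ b)
    {G : Set (Fin n → Ω)} (hG : MeasurableSet G)
    (hGB : ∀ X' ∈ G, ∀ x, |sampleMean (fun y => k y x) X'| ≤ B)
    (hL0 : 0 < L) (hL1 : 12 * (2 * B + 4 * F) * F ≤ L) (hL2 : 24 * F * A ≤ L)
    (hL3 : 36 * (2 * B + 4 * F) ^ 2 + 144 * A ^ 2 ≤ 2 * L) :
    ∫ D, (Prod.snd ⁻¹' G).indicator (fun D : (Fin n → Ω) × (Fin n → Ω) => Real.exp (n / L *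
        (∫ x, g x ^ 2 ∂μ + 6 * sampleMean (gain k f₀ g D.2) D.1 - 12 * b ^ 2))) D
      ∂(Measure.pi fun _ => μ).prod (Measure.pi fun _ => μ) ≤ 1 := by
  have hn0 : (0 : ℝ) < n := by exact_mod_cast hn
  obtain ⟨x₀⟩ : Nonempty Ω := nonempty_of_isProbabilityMeasure μ
  have hF0 : 0 ≤ F := (abs_nonneg _).trans (hf₀F x₀)
  have hq0 : 0 ≤ ∫ x, g x ^ 2 ∂μ := integral_nonneg fun x => sq_nonneg _
  have hint := integrable_indicator_exp_gain (μ := μ) (b := b) (s := n / L)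
    (q := ∫ x, g x ^ 2 ∂μ) hk hκ hf₀ hf₀F hg hgF hG (by positivity)
  have hφm : Measurable fun y => ∫ x, k y x * g x ∂μ :=
    (StronglyMeasurable.integral_prod_right
      (hk.mul (hg.comp measurable_snd)).stronglyMeasurable).measurable
  have hφb : ∀ y, |∫ x, k y x * g x ∂μ| ≤ 2 * F * A := fun y => by
    calc |∫ x, k y x * g x ∂μ| ≤ ∫ x, |k y x * g x| ∂μ := abs_integral_le_integral_abs
      _ ≤ ∫ x, |k y x| * (2 * F) ∂μ := by
        refine integral_mono (integrable_kernel_mul hk hκ hg hgF y).abs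
          ((integrable_of_abs_le (hk.comp measurable_prodMk_left) (hκ y)).abs.mul_const _)
          fun x => ?_
        simp only [abs_mul]
        exact mul_le_mul_of_nonneg_left (hgF x) (abs_nonneg _)
      _ ≤ _ := by
        rw [integral_mul_const, mul_comm]
        exact mul_le_mul_of_nonneg_left (hA2 y) (by positivity)
  have hφ2 := integral_sq_integral_mul_le μ hk hκ hA hA1 hA2 hg hgF
  have hφint := integral_integral_kernel_mul_sub_le (μ := μ) hk hκ hf₀ hf₀F hg hgF hb
  have hcond := fun (X' : Fin n → Ω) hX' => integral_exp_sampleMean_gain_le (μ := μ) (b := b) hn hk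
    hκ hf₀ hf₀F hg hgF (hGB X' hX') hL0 hL1
  set q := ∫ x, g x ^ 2 ∂μ
  set r := ∫ x, f₀ x * g x ∂μ
  set φ : Ω → ℝ := fun y => ∫ x, k y x * g x ∂μ
  set c₀ : ℝ := n / L * (-5 * q - 12 * b ^ 2 - 12 * r + 36 / L * ((2 * B + 4 * F) ^ 2 * q))
    with hc₀
  -- Off G the left side is 0, so the bound holds for every X' and its right side is a product over
  -- the coordinates of X'.
  have hinner : ∀ X', ∫ X : Fin n → Ω, (Prod.snd ⁻¹' G).indicator
      (fun D : (Fin n → Ω) × (Fin n → Ω) =>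
        Real.exp (n / L * (q + 6 * sampleMean (gain k f₀ g D.2) D.1 - 12 * b ^ 2))) (X, X')
      ∂(Measure.pi fun _ => μ) ≤ Real.exp c₀ * Real.exp (12 / L * ∑ l, φ (X' l)) := fun X' => by
    by_cases hX' : X' ∈ G
    · refine le_trans (le_of_eq (integral_congr_ae (ae_of_all _ fun X => ?_))) (hcond X' hX')
      exact Set.indicator_of_mem (by simpa using hX') _
    · refine le_trans (le_of_eq (integral_eq_zero_of_ae (ae_of_all _ fun X => ?_)))
        (by positivity)
      exact Set.indicator_of_notMem (by simpa using hX') _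
  rw [integral_prod_symm _ hint]
  have hint2 : Integrable (fun X' : Fin n → Ω =>
      Real.exp c₀ * Real.exp (12 / L * ∑ l, φ (X' l))) (Measure.pi fun _ => μ) := by
    refine Integrable.const_mul (integrable_of_abs_le ?_
      (C := Real.exp (12 / L * (n * (2 * F * A)))) fun X' => ?_) _
    · exact Real.measurable_exp.comp (measurable_const.mul
        (Finset.measurable_sum _ fun l _ => hφm.comp (measurable_pi_apply l)))
    · rw [abs_of_pos (Real.exp_pos _), Real.exp_le_exp]
      refine mul_le_mul_of_nonneg_left ?_ (by positivity)
      refine (Finset.sum_le_sum fun l _ => le_of_abs_le (hφb (X' l))).trans ?_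
      simp
  refine (integral_mono hint.integral_prod_right hint2 hinner).trans ?_
  rw [integral_const_mul]
  refine (mul_le_mul_of_nonneg_left (integral_exp_sum_le μ hφm hφb ?_ n)
    (Real.exp_pos _).le).trans ?_
  · rw [abs_of_pos (by positivity), div_mul_eq_mul_div, div_le_one hL0]
    linarith
  · rw [← Real.exp_add, ← Real.exp_zero, Real.exp_le_exp, hc₀]
    -- The two second-moment terms, one for each sample (36 = 6², 144 = 12²), must fit in the
    -- remaining 2q; this is what `hL3` says.
    have h1 : 36 / L * ((2 * B + 4 * F) ^ 2 * q) + 144 / L * (A ^ 2 * q) ≤ 2 * q := by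
      have : 36 / L * ((2 * B + 4 * F) ^ 2 * q) + 144 / L * (A ^ 2 * q) =
        (36 * (2 * B + 4 * F) ^ 2 + 144 * A ^ 2) / L * q := by field_simp
      rw [this]
      refine mul_le_mul_of_nonneg_right ?_ hq0
      rwa [div_le_iff₀ hL0]
    have h2 : 144 / L * ∫ y, φ y ^ 2 ∂μ ≤ 144 / L * (A ^ 2 * q) :=
      mul_le_mul_of_nonneg_left hφ2 (by positivity)
    have e : n / L * (-5 * q - 12 * b ^ 2 - 12 * r + 36 / L * ((2 * B + 4 * F) ^ 2 * q)) +
        n * (12 / L * ∫ x, φ x ∂μ + (12 / L) ^ 2 * ∫ x, φ x ^ 2 ∂μ) =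
        n / L * (-5 * q - 12 * b ^ 2 + 12 * (∫ x, φ x ∂μ - r) +
        36 / L * ((2 * B + 4 * F) ^ 2 * q) + 144 / L * ∫ x, φ x ^ 2 ∂μ) := by
      field_simp; ring
    rw [e]
    refine mul_nonpos_of_nonneg_of_nonpos (by positivity) ?_
    linarith

end Abstract

/-! ### Algebra of sample means -/

section SampleMean

variable {Ω : Type*} {n : ℕ}

theorem sampleMean_add (φ ψ : Ω → ℝ) (X : Fin n → Ω) :
    sampleMean (fun x => φ x + ψ x) X = sampleMean φ X + sampleMean ψ X := by
  unfold sampleMean; rw [Finset.sum_add_distrib, mul_add]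

theorem sampleMean_sub (φ ψ : Ω → ℝ) (X : Fin n → Ω) :
    sampleMean (fun x => φ x - ψ x) X = sampleMean φ X - sampleMean ψ X := by
  unfold sampleMean; rw [Finset.sum_sub_distrib, mul_sub]

theorem sampleMean_const_mul (c : ℝ) (φ : Ω → ℝ) (X : Fin n → Ω) :
    sampleMean (fun x => c * φ x) X = c * sampleMean φ X := by
  unfold sampleMean; rw [← Finset.mul_sum]; ring

theorem sampleMean_const (hn : 0 < n) (c : ℝ) (X : Fin n → Ω) :
    sampleMean (fun _ => c) X = c := by
  have : (n : ℝ) ≠ 0 := by exact_mod_cast hn.ne'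
  unfold sampleMean; simp; field_simp

theorem sampleMean_mono {φ ψ : Ω → ℝ} (h : ∀ x, φ x ≤ ψ x) (X : Fin n → Ω) :
    sampleMean φ X ≤ sampleMean ψ X := by
  unfold sampleMean
  exact mul_le_mul_of_nonneg_left (Finset.sum_le_sum fun i _ => h _) (by positivity)

theorem abs_sampleMean_le_sampleMean_abs (φ : Ω → ℝ) (X : Fin n → Ω) :
    |sampleMean φ X| ≤ sampleMean (fun x => |φ x|) X := by
  unfold sampleMean
  rw [abs_mul, abs_of_nonneg (by positivity : (0 : ℝ) ≤ 1 / n)]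
  exact mul_le_mul_of_nonneg_left (Finset.abs_sum_le_sum_abs _ _) (by positivity)

end SampleMean

/-! ### From a finite net to the oracle inequality -/

section Abstract

variable {Ω : Type*} [MeasurableSpace Ω]

/-- The tangent of exp at log N. It replaces a maximum over a net of N points by a sum of
exponentials, linearly, so that taking expectations gives log N + 1 directly. -/
theorem le_log_add_exp_div {x s N : ℝ} (hs : 0 < s) (hN : 0 < N) :
    x ≤ 1 / s * (Real.log N + Real.exp (s * x) / N) := by
  have h := Real.add_one_le_exp (s * x - Real.log N)
  rw [Real.exp_sub, Real.exp_log hN] at h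
  rw [one_div, ← div_eq_inv_mul, le_div_iff₀ hs]
  linarith

theorem abs_sub_le_two_mul {a b F : ℝ} (ha : |a| ≤ F) (hb : |b| ≤ F) : |a - b| ≤ 2 * F := by
  have := abs_sub a b
  linarith

theorem abs_sq_sub_sq_le {u f c F δ : ℝ} (hu : |u| ≤ F) (hf : |f| ≤ F) (hc : |c| ≤ F)
    (hδ : |u - f| ≤ δ) : |(u - c) ^ 2 - (f - c) ^ 2| ≤ 4 * F * δ := by
  have e : (u - c) ^ 2 - (f - c) ^ 2 = (u - f) * ((u - c) + (f - c)) := by ring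
  rw [e, abs_mul, mul_comm]
  refine mul_le_mul ?_ hδ (abs_nonneg _) (by linarith [(abs_nonneg u).trans hu])
  linarith [abs_add_le (u - c) (f - c), abs_sub_le_two_mul hu hc, abs_sub_le_two_mul hf hc]

/-- Passing from a function to an element of a `δ`-net. -/
theorem risk_add_gain_le_of_net {μ : Measure Ω} [IsProbabilityMeasure μ] {n : ℕ} (hn : 0 < n)
    {k : Ω → Ω → ℝ} {F δ : ℝ} {f₀ u f : Ω → ℝ} (hf₀ : Measurable f₀) (hf₀F : ∀ x, |f₀ x| ≤ F)
    (hu : Measurable u) (huF : ∀ x, |u x| ≤ F) (hf : Measurable f) (hfF : ∀ x, |f x| ≤ F)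
    (hδ : ∀ x, |u x - f x| ≤ δ) (X X' : Fin n → Ω) :
    ∫ x, (u x - f₀ x) ^ 2 ∂μ + 6 * sampleMean (gain k f₀ (fun x => u x - f₀ x) X') X ≤
      ∫ x, (f x - f₀ x) ^ 2 ∂μ + 6 * sampleMean (gain k f₀ (fun x => f x - f₀ x) X') X +
      δ * (28 * F + 12 * sampleMean (fun x => sampleMean (fun y => |k y x| + F) X') X) := by
  have h1 : ∫ x, (u x - f₀ x) ^ 2 ∂μ ≤ ∫ x, (f x - f₀ x) ^ 2 ∂μ + 4 * F * δ := by
    have hi : Integrable (fun x => (f x - f₀ x) ^ 2) μ :=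
      integrable_sq_of_abs_le (hf.sub hf₀) fun x => abs_sub_le_two_mul (hfF x) (hf₀F x)
    have : ∫ x, (u x - f₀ x) ^ 2 ∂μ ≤ ∫ x, ((f x - f₀ x) ^ 2 + 4 * F * δ) ∂μ := by
      refine integral_mono (integrable_sq_of_abs_le (hu.sub hf₀)
        fun x => abs_sub_le_two_mul (huF x) (hf₀F x)) (hi.add (integrable_const _)) fun x => ?_
      simp only
      linarith [(abs_le.1 (abs_sq_sub_sq_le (huF x) (hfF x) (hf₀F x) (hδ x))).2]
    rw [integral_add hi (integrable_const _)] at this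
    simpa using this
  have h2 : sampleMean (gain k f₀ (fun x => u x - f₀ x) X') X ≤
      sampleMean (fun x => gain k f₀ (fun x => f x - f₀ x) X' x +
        ((2 * δ) * sampleMean (fun y => |k y x| + F) X' + 4 * F * δ)) X := by
    refine sampleMean_mono (fun x => ?_) X
    have h3 := (abs_le.1 (abs_sq_sub_sq_le (huF x) (hfF x) (hf₀F x) (hδ x))).1
    -- The slope of the gain in g is bounded by a random average and not by B: its expectation is at
    -- most A + F with no restriction to a good event.
    have h4 : |sampleMean (fun y => k y x) X' - f₀ x| ≤ sampleMean (fun y => |k y x| + F) X' := by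
      rw [sampleMean_add, sampleMean_const hn]
      refine (abs_sub _ _).trans (add_le_add (abs_sampleMean_le_sampleMean_abs _ _) (hf₀F x))
    have h5 : (sampleMean (fun y => k y x) X' - f₀ x) * (u x - f x) ≤
        sampleMean (fun y => |k y x| + F) X' * δ := by
      refine (le_abs_self _).trans ?_
      rw [abs_mul]
      exact mul_le_mul h4 (hδ x) (abs_nonneg _) ((abs_nonneg _).trans h4)
    unfold gain
    linarith
  rw [sampleMean_add, sampleMean_add, sampleMean_const_mul, sampleMean_const hn] at h2
  linarith

/-- The uncentred empirical process inequality for an estimator with values near a finite net. -/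
theorem integral_risk_add_gain_le {μ : Measure Ω} [IsProbabilityMeasure μ] {n : ℕ} (hn : 0 < n)
    {k : Ω → Ω → ℝ} (hk : Measurable (Function.uncurry k)) {κ A B F b L δ : ℝ}
    (hκ : ∀ y x, |k y x| ≤ κ) (hA : 0 < A)
    (hA1 : ∀ x, ∫ y, |k y x| ∂μ ≤ A) (hA2 : ∀ y, ∫ x, |k y x| ∂μ ≤ A)
    {f₀ : Ω → ℝ} (hf₀ : Measurable f₀) (hf₀F : ∀ x, |f₀ x| ≤ F)
    (hb : ∀ x, |∫ y, k y x ∂μ - f₀ x| ≤ b)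
    {G : Set (Fin n → Ω)} (hG : MeasurableSet G)
    (hGB : ∀ X' ∈ G, ∀ x, |sampleMean (fun y => k y x) X'| ≤ B)
    (hL0 : 0 < L) (hL1 : 12 * (2 * B + 4 * F) * F ≤ L) (hL2 : 24 * F * A ≤ L)
    (hL3 : 36 * (2 * B + 4 * F) ^ 2 + 144 * A ^ 2 ≤ 2 * L)
    {u : (Fin n → Ω) × (Fin n → Ω) → Ω → ℝ} (hu : Measurable (Function.uncurry u))
    (huF : ∀ D x, |u D x| ≤ F) {ι : Type*} [Fintype ι] [Nonempty ι] {f : ι → Ω → ℝ}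
    (hf : ∀ j, Measurable (f j)) (hfF : ∀ j x, |f j x| ≤ F) (hδ0 : 0 ≤ δ)
    (hcov : ∀ D, ∃ j, ∀ x, |u D x - f j x| ≤ δ) :
    Integrable (fun D => ∫ x, (u D x - f₀ x) ^ 2 ∂μ +
        6 * sampleMean (gain k f₀ (fun x => u D x - f₀ x) D.2) D.1)
        ((Measure.pi fun _ => μ).prod (Measure.pi fun _ => μ)) ∧
    ∫ D, (∫ x, (u D x - f₀ x) ^ 2 ∂μ + 6 * sampleMean (gain k f₀ (fun x => u D x - f₀ x) D.2) D.1)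
      ∂(Measure.pi fun _ => μ).prod (Measure.pi fun _ => μ) ≤
    δ * (28 * F + 12 * (A + F)) + 12 * b ^ 2 + L / n * (Real.log (Fintype.card ι) + 1) +
      (4 * F ^ 2 + 24 * F * (κ + F)) * (Measure.pi fun _ : Fin n => μ).real Gᶜ := by
  obtain ⟨x₀⟩ : Nonempty Ω := nonempty_of_isProbabilityMeasure μ
  have hn0 : (0 : ℝ) < n := by exact_mod_cast hn
  have hκ0 : 0 ≤ κ := (abs_nonneg _).trans (hκ x₀ x₀)
  have hF0 : 0 ≤ F := (abs_nonneg _).trans (hf₀F x₀)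
  have hN : (0 : ℝ) < Fintype.card ι := by exact_mod_cast Fintype.card_pos
  have huD : ∀ D, Measurable (u D) := fun D => hu.comp measurable_prodMk_left
  have hgF : ∀ D x, |u D x - f₀ x| ≤ 2 * F := fun D x => abs_sub_le_two_mul (huF D x) (hf₀F x)
  have hWb : ∀ D, |∫ x, (u D x - f₀ x) ^ 2 ∂μ +
      6 * sampleMean (gain k f₀ (fun x => u D x - f₀ x) D.2) D.1| ≤
      (2 * F) ^ 2 + 6 * ((2 * κ + 4 * F) * (2 * F)) := fun D => by
    refine (abs_add_le _ _).trans (add_le_add ?_ ?_)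
    · refine (norm_integral_le_of_norm_le_const (μ := μ) (f := fun x => (u D x - f₀ x) ^ 2)
        (ae_of_all _ fun x => abs_sq_le_sq_of_abs_le (hgF D x))).trans ?_
      simp
    · rw [abs_mul, abs_of_pos (by norm_num : (0 : ℝ) < 6)]
      refine mul_le_mul_of_nonneg_left (abs_sampleMean_le (by positivity) (fun x => ?_) _)
        (by norm_num)
      exact abs_gain_le hf₀F (hgF D) (abs_sampleMean_le hκ0 (fun y => hκ y x) D.2)
  have hgm : Measurable (Function.uncurry fun D x => u D x - f₀ x) :=
    hu.sub (hf₀.comp measurable_snd)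
  have hWm : Measurable fun D => ∫ x, (u D x - f₀ x) ^ 2 ∂μ +
      6 * sampleMean (gain k f₀ (fun x => u D x - f₀ x) D.2) D.1 := by
    refine Measurable.add ?_ (measurable_const.mul (measurable_sampleMean
      (ψ := fun D => gain k f₀ (fun x => u D x - f₀ x) D.2) ?_ measurable_fst))
    · exact (StronglyMeasurable.integral_prod_right
        (hgm.pow_const 2).stronglyMeasurable).measurable
    · unfold gain
      refine Measurable.sub ?_ (hgm.pow_const 2)
      refine ((Measurable.sub ?_ (hf₀.comp measurable_snd)).const_mul 2).mul hgm
      exact (measurable_kernelMean hk).comp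
        ((measurable_snd.comp measurable_fst).prodMk measurable_snd)
  have hWi := integrable_of_abs_le (μ := (Measure.pi fun _ : Fin n => μ).prod
    (Measure.pi fun _ : Fin n => μ)) hWm hWb
  refine ⟨hWi, ?_⟩
  set P := (Measure.pi fun _ : Fin n => μ).prod (Measure.pi fun _ : Fin n => μ) with hP
  set E : ι → (Fin n → Ω) × (Fin n → Ω) → ℝ := fun j => (Prod.snd ⁻¹' G).indicator
    (fun D => Real.exp (n / L * (∫ x, (f j x - f₀ x) ^ 2 ∂μ +
      6 * sampleMean (gain k f₀ (fun x => f j x - f₀ x) D.2) D.1 - 12 * b ^ 2))) with hE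
  have hE0 : ∀ j D, 0 ≤ E j D := fun j D =>
    Set.indicator_nonneg (fun D _ => (Real.exp_pos _).le) D
  have hfjF : ∀ j x, |f j x - f₀ x| ≤ 2 * F := fun j x => abs_sub_le_two_mul (hfF j x) (hf₀F x)
  have hEi : ∀ j, Integrable (E j) P := fun j =>
    integrable_indicator_exp_gain hk hκ hf₀ hf₀F ((hf j).sub hf₀) (hfjF j) hG (by positivity)
  have hE1 : ∀ j, ∫ D, E j D ∂P ≤ 1 := fun j =>
    exp_moment_sample_le hn hk hκ hA hA1 hA2 hf₀ hf₀F ((hf j).sub hf₀) (hfjF j) hb hG hGB hL0 hL1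
      hL2 hL3
  set S : (Fin n → Ω) × (Fin n → Ω) → ℝ := fun D =>
    sampleMean (fun x => sampleMean (fun y => |k y x| + F) D.2) D.1 with hS
  have hkF : Measurable (Function.uncurry fun x y => |k y x| + F) :=
    (measurable_norm.comp (hk.comp measurable_swap)).add measurable_const
  have hkFb : ∀ x y, |(|k y x| + F)| ≤ κ + F := fun x y => by
    rw [abs_of_nonneg (by positivity)]
    exact add_le_add_left (hκ y x) F
  have hSm : Measurable S := by
    refine measurable_sampleMean (ψ := fun (D : (Fin n → Ω) × (Fin n → Ω)) x =>
      sampleMean (fun y => |k y x| + F) D.2) ?_ measurable_fst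
    refine measurable_sampleMean (ψ := fun (q : ((Fin n → Ω) × (Fin n → Ω)) × Ω) y =>
      |k y q.2| + F) (X := fun q : ((Fin n → Ω) × (Fin n → Ω)) × Ω => q.1.2) ?_
      (measurable_snd.comp measurable_fst)
    exact hkF.comp ((measurable_snd.comp measurable_fst).prodMk measurable_snd)
  have hSi : Integrable S P := integrable_of_abs_le hSm fun D =>
    abs_sampleMean_le (by positivity) (fun x => abs_sampleMean_le (by positivity) (hkFb x) D.2) D.1
  have hS1 : ∫ D, S D ∂P ≤ A + F := by
    rw [hS, hP, integral_sampleMean_sampleMean μ hn hkF hkFb]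
    have hi : Integrable (fun x => ∫ y, (|k y x| + F) ∂μ) μ :=
      (integrable_of_abs_le (μ := μ.prod μ) hkF fun p => hkFb p.1 p.2).integral_prod_left
    refine (integral_mono hi (integrable_const (A + F)) fun x => ?_).trans (by simp)
    simp only
    have hkx : Integrable (fun y => k y x) μ :=
      integrable_of_abs_le (hk.comp measurable_prodMk_right) fun y => hκ y x
    rw [integral_add hkx.abs (integrable_const _)]
    simpa using hA1 x
  -- On G: move to a net point, then bound its exponential by the sum over the net. Off G: use the
  -- trivial bounds, the other terms being nonnegative.
  have hpt : ∀ D, ∫ x, (u D x - f₀ x) ^ 2 ∂μ +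
      6 * sampleMean (gain k f₀ (fun x => u D x - f₀ x) D.2) D.1 ≤
      (δ * (28 * F + 12 * S D) + (12 * b ^ 2 + L / n * (Real.log (Fintype.card ι) +
        (∑ j, E j D) / Fintype.card ι))) +
      (Prod.snd ⁻¹' Gᶜ).indicator (fun _ => 4 * F ^ 2 + 24 * F * (κ + F)) D := fun D => by
    have hS0 : 0 ≤ S D := by
      have := sampleMean_mono (n := n) (φ := fun _ => (0 : ℝ))
        (ψ := fun x => sampleMean (fun y => |k y x| + F) D.2) (fun x => by
          have := sampleMean_mono (n := n) (φ := fun _ : Ω => (0 : ℝ))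
            (ψ := fun y => |k y x| + F) (fun y => by positivity) D.2
          rwa [sampleMean_const hn] at this) D.1
      rwa [sampleMean_const hn] at this
    by_cases hD : D.2 ∈ G
    · rw [Set.indicator_of_notMem (by simpa using hD), add_zero]
      obtain ⟨j, hj⟩ := hcov D
      have h1 := risk_add_gain_le_of_net (μ := μ) (k := k) hn hf₀ hf₀F (huD D) (huF D) (hf j)
        (hfF j) hj D.1 D.2
      have h2 := le_log_add_exp_div (x := ∫ x, (f j x - f₀ x) ^ 2 ∂μ +
        6 * sampleMean (gain k f₀ (fun x => f j x - f₀ x) D.2) D.1 - 12 * b ^ 2)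
        (by positivity : 0 < n / L) hN
      have h3 : Real.exp (n / L * (∫ x, (f j x - f₀ x) ^ 2 ∂μ +
        6 * sampleMean (gain k f₀ (fun x => f j x - f₀ x) D.2) D.1 - 12 * b ^ 2)) ≤ ∑ j, E j D := by
        refine le_trans (le_of_eq ?_) (Finset.single_le_sum (f := fun j => E j D)
          (fun j _ => hE0 j D) (Finset.mem_univ j))
        have hD' : D ∈ Prod.snd ⁻¹' G := hD
        simp only [hE]
        rw [Set.indicator_of_mem hD']
      rw [one_div_div] at h2
      have h4 : L / n * (Real.log (Fintype.card ι) + Real.exp (n / L * (∫ x, (f j x - f₀ x) ^ 2 ∂μ +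
        6 * sampleMean (gain k f₀ (fun x => f j x - f₀ x) D.2) D.1 - 12 * b ^ 2)) / Fintype.card ι)
          ≤ L / n * (Real.log (Fintype.card ι) + (∑ j, E j D) / Fintype.card ι) := by
        gcongr
      linarith
    · rw [Set.indicator_of_mem (by simpa using hD)]
      have h1 : 0 ≤ δ * (28 * F + 12 * S D) + (12 * b ^ 2 + L / n * (Real.log (Fintype.card ι) +
          (∑ j, E j D) / Fintype.card ι)) := by
        have := Real.log_nonneg (by exact_mod_cast Fintype.card_pos : (1 : ℝ) ≤ Fintype.card ι)
        have := Finset.sum_nonneg (s := Finset.univ) fun j _ => hE0 j D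
        positivity
      -- Off G the risk is at most 4F² and the gain, without its term -g², at most 4F(κ + F); the
      -- factor 6 gives 24.
      have h2 : ∫ x, (u D x - f₀ x) ^ 2 ∂μ ≤ 4 * F ^ 2 := by
        refine (integral_mono (integrable_sq_of_abs_le ((huD D).sub hf₀) (hgF D))
          (integrable_const ((2 * F) ^ 2)) fun x => sq_le_sq_of_abs_le (hgF D x)).trans ?_
        simp
        linarith
      have h3 : sampleMean (gain k f₀ (fun x => u D x - f₀ x) D.2) D.1 ≤ 4 * F * (κ + F) := by
        refine (sampleMean_mono (fun x => ?_) D.1).trans (sampleMean_const hn _ D.1).le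
        have h4 : |sampleMean (fun y => k y x) D.2 - f₀ x| ≤ κ + F :=
          (abs_sub _ _).trans (add_le_add (abs_sampleMean_le hκ0 (fun y => hκ y x) D.2) (hf₀F x))
        have h5 : (sampleMean (fun y => k y x) D.2 - f₀ x) * (u D x - f₀ x) ≤
            (κ + F) * (2 * F) := by
          refine (le_abs_self _).trans ?_
          rw [abs_mul]
          exact mul_le_mul h4 (hgF D x) (abs_nonneg _) (by positivity)
        unfold gain
        nlinarith [sq_nonneg (u D x - f₀ x)]
      linarith
  have hi1 : Integrable (fun D => δ * (28 * F + 12 * S D)) P :=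
    ((integrable_const _).add (hSi.const_mul 12)).const_mul δ
  have hi2 : Integrable (fun D => ∑ j, E j D) P := integrable_finsetSum _ fun j _ => hEi j
  have hi3 : Integrable (fun D => 12 * b ^ 2 + L / n * (Real.log (Fintype.card ι) +
        (∑ j, E j D) / Fintype.card ι)) P :=
    (integrable_const _).add (((integrable_const _).add (hi2.div_const _)).const_mul _)
  have hi4 : Integrable ((Prod.snd ⁻¹' Gᶜ).indicator
      (fun _ : (Fin n → Ω) × (Fin n → Ω) => 4 * F ^ 2 + 24 * F * (κ + F))) P :=
    (integrable_const _).indicator (measurable_snd hG.compl)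
  refine (integral_mono hWi ((hi1.add hi3).add hi4) hpt).trans ?_
  have e4 : ∫ D, (Prod.snd ⁻¹' Gᶜ).indicator
      (fun _ : (Fin n → Ω) × (Fin n → Ω) => 4 * F ^ 2 + 24 * F * (κ + F)) D ∂P =
      (4 * F ^ 2 + 24 * F * (κ + F)) * (Measure.pi fun _ : Fin n => μ).real Gᶜ := by
    rw [integral_indicator_const _ (measurable_snd hG.compl), smul_eq_mul, mul_comm]
    congr 1
    rw [hP, measureReal_def, measureReal_def]
    congr 1
    exact measurePreserving_snd.measure_preimage hG.compl.nullMeasurableSet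
  have e1 : ∫ D, δ * (28 * F + 12 * S D) ∂P ≤ δ * (28 * F + 12 * (A + F)) := by
    rw [integral_const_mul, integral_add (integrable_const _) (hSi.const_mul 12),
      integral_const_mul]
    simp only [integral_const, integral_const_mul, probReal_univ, smul_eq_mul, one_mul]
    gcongr
  have e3 : ∫ D, (12 * b ^ 2 + L / n * (Real.log (Fintype.card ι) +
        (∑ j, E j D) / Fintype.card ι)) ∂P ≤
      12 * b ^ 2 + L / n * (Real.log (Fintype.card ι) + 1) := by
    have hi5 : Integrable (fun D => L / n * (Real.log (Fintype.card ι) +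
        (∑ j, E j D) / Fintype.card ι)) P :=
      ((integrable_const _).add (hi2.div_const _)).const_mul _
    rw [integral_add (integrable_const _) hi5,
      integral_const_mul (L / (n : ℝ)), integral_add (integrable_const _) (hi2.div_const _),
      integral_div,
      integral_finsetSum _ fun j _ => hEi j]
    simp only [integral_const, probReal_univ, smul_eq_mul, one_mul]
    have : (∑ j, ∫ D, E j D ∂P) / Fintype.card ι ≤ 1 := by
      rw [div_le_one hN]
      refine (Finset.sum_le_sum fun j _ => hE1 j).trans ?_
      simp
    gcongr
  have hsplit : ∫ D, ((δ * (28 * F + 12 * S D) + (12 * b ^ 2 + L / n * (Real.log (Fintype.card ι) +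
        (∑ j, E j D) / Fintype.card ι))) +
      (Prod.snd ⁻¹' Gᶜ).indicator (fun _ => 4 * F ^ 2 + 24 * F * (κ + F)) D) ∂P =
      ∫ D, δ * (28 * F + 12 * S D) ∂P + ∫ D, (12 * b ^ 2 + L / n * (Real.log (Fintype.card ι) +
        (∑ j, E j D) / Fintype.card ι)) ∂P + ∫ D, (Prod.snd ⁻¹' Gᶜ).indicator
      (fun _ : (Fin n → Ω) × (Fin n → Ω) => 4 * F ^ 2 + 24 * F * (κ + F)) D ∂P := by
    rw [← integral_add hi1 hi3]
    exact integral_add (hi1.add hi3) hi4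
  refine hsplit.le.trans ?_
  linarith

/-- As v is fixed, averaging over both samples turns k̄ into its mean, and -2 bias · g ≤ 6 bias² +
g²/6. The weight 1/6 is what makes the final factor 6 · (7/6) = 7. -/
theorem integral_comparison_le {μ : Measure Ω} [IsProbabilityMeasure μ] {n : ℕ} (hn : 0 < n)
    {k : Ω → Ω → ℝ} (hk : Measurable (Function.uncurry k)) {κ F b : ℝ}
    (hκ : ∀ y x, |k y x| ≤ κ)
    {f₀ v : Ω → ℝ} (hf₀ : Measurable f₀) (hf₀F : ∀ x, |f₀ x| ≤ F) (hv : Measurable v)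
    (hvF : ∀ x, |v x| ≤ F) (hb : ∀ x, |∫ y, k y x ∂μ - f₀ x| ≤ b) :
    Integrable (fun D : (Fin n → Ω) × (Fin n → Ω) => sampleMean (fun x => sampleMean
        (fun y => (v x - f₀ x) ^ 2 - 2 * (k y x - f₀ x) * (v x - f₀ x)) D.2) D.1)
        ((Measure.pi fun _ => μ).prod (Measure.pi fun _ => μ)) ∧
    6 * ∫ D : (Fin n → Ω) × (Fin n → Ω), sampleMean (fun x => sampleMean
        (fun y => (v x - f₀ x) ^ 2 - 2 * (k y x - f₀ x) * (v x - f₀ x)) D.2) D.1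
      ∂(Measure.pi fun _ => μ).prod (Measure.pi fun _ => μ) ≤
    7 * ∫ x, (v x - f₀ x) ^ 2 ∂μ + 36 * b ^ 2 := by
  obtain ⟨x₀⟩ : Nonempty Ω := nonempty_of_isProbabilityMeasure μ
  have hκ0 : 0 ≤ κ := (abs_nonneg _).trans (hκ x₀ x₀)
  have hF0 : 0 ≤ F := (abs_nonneg _).trans (hf₀F x₀)
  have hvf : ∀ x, |v x - f₀ x| ≤ 2 * F := fun x => abs_sub_le_two_mul (hvF x) (hf₀F x)
  have hξ : Measurable (Function.uncurry fun x y =>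
      (v x - f₀ x) ^ 2 - 2 * (k y x - f₀ x) * (v x - f₀ x)) := by
    have h1 : Measurable fun p : Ω × Ω => v p.1 - f₀ p.1 := (hv.sub hf₀).comp measurable_fst
    refine (h1.pow_const 2).sub (Measurable.mul (measurable_const.mul ?_) h1)
    exact (hk.comp measurable_swap).sub (hf₀.comp measurable_fst)
  have hξb : ∀ x y, |(v x - f₀ x) ^ 2 - 2 * (k y x - f₀ x) * (v x - f₀ x)| ≤
      (2 * F) ^ 2 + 2 * (κ + F) * (2 * F) := fun x y => by
    refine (abs_sub _ _).trans (add_le_add (abs_sq_le_sq_of_abs_le (hvf x)) ?_)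
    rw [abs_mul, abs_mul, abs_two]
    refine mul_le_mul (mul_le_mul_of_nonneg_left ?_ zero_le_two) (hvf x) (abs_nonneg _)
      (by positivity)
    exact (abs_sub _ _).trans (add_le_add (hκ y x) (hf₀F x))
  constructor
  · refine integrable_of_abs_le ?_ fun D => abs_sampleMean_le (by positivity)
      (fun x => abs_sampleMean_le (by positivity) (hξb x) D.2) D.1
    refine measurable_sampleMean (ψ := fun (D : (Fin n → Ω) × (Fin n → Ω)) x => sampleMean
      (fun y => (v x - f₀ x) ^ 2 - 2 * (k y x - f₀ x) * (v x - f₀ x)) D.2) ?_ measurable_fst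
    refine measurable_sampleMean (ψ := fun (q : ((Fin n → Ω) × (Fin n → Ω)) × Ω) y =>
      (v q.2 - f₀ q.2) ^ 2 - 2 * (k y q.2 - f₀ q.2) * (v q.2 - f₀ q.2))
      (X := fun q : ((Fin n → Ω) × (Fin n → Ω)) × Ω => q.1.2) ?_
      (measurable_snd.comp measurable_fst)
    exact hξ.comp ((measurable_snd.comp measurable_fst).prodMk measurable_snd)
  rw [integral_sampleMean_sampleMean μ hn hξ hξb]
  have hsq : Integrable (fun x => (v x - f₀ x) ^ 2) μ := integrable_sq_of_abs_le (hv.sub hf₀) hvf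
  have hinner : ∀ x, ∫ y, ((v x - f₀ x) ^ 2 - 2 * (k y x - f₀ x) * (v x - f₀ x)) ∂μ ≤
      7 / 6 * (v x - f₀ x) ^ 2 + 6 * b ^ 2 := fun x => by
    have hkx : Integrable (fun y => k y x) μ :=
      integrable_of_abs_le (hk.comp measurable_prodMk_right) fun y => hκ y x
    have hkx1 : Integrable (fun y => k y x - f₀ x) μ := hkx.sub (integrable_const _)
    have hkx2 : Integrable (fun y => 2 * (k y x - f₀ x) * (v x - f₀ x)) μ :=
      (hkx1.const_mul 2).mul_const _
    rw [integral_sub (integrable_const _) hkx2, integral_mul_const, integral_const_mul,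
      integral_sub hkx (integrable_const _)]
    simp only [integral_const, probReal_univ, smul_eq_mul, one_mul]
    have h := sq_le_sq_of_abs_le (hb x)
    nlinarith [sq_nonneg (6 * (∫ y, k y x ∂μ - f₀ x) + (v x - f₀ x))]
  have hi : Integrable (fun x =>
      ∫ y, ((v x - f₀ x) ^ 2 - 2 * (k y x - f₀ x) * (v x - f₀ x)) ∂μ) μ :=
    (integrable_of_abs_le (μ := μ.prod μ) hξ fun p => hξb p.1 p.2).integral_prod_left
  have h := integral_mono hi ((hsq.const_mul (7 / 6)).add (integrable_const (6 * b ^ 2))) hinner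
  simp only [Pi.add_apply] at h
  rw [integral_add (hsq.const_mul _) (integrable_const _), integral_const_mul] at h
  simp only [integral_const, probReal_univ, smul_eq_mul, one_mul] at h
  linarith

theorem integral_eq_add_const_mul_add {μ : Measure Ω} {f w l φ : Ω → ℝ} {c : ℝ}
    (hw : Integrable w μ) (hl : Integrable l μ) (hφ : Integrable φ μ)
    (h : ∀ x, f x = w x + c * l x + c * φ x) :
    ∫ x, f x ∂μ = ∫ x, w x ∂μ + c * ∫ x, l x ∂μ + c * ∫ x, φ x ∂μ := by
  have h1 : Integrable (fun x => c * l x) μ := hl.const_mul c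
  have h2 : Integrable (fun x => w x + c * l x) μ := hw.add h1
  simp_rw [h]
  rw [integral_add h2 (hφ.const_mul c), integral_add hw h1, integral_const_mul, integral_const_mul]

theorem integrable_sampleMean_sq_sub {μ : Measure Ω} [IsProbabilityMeasure μ] {n : ℕ}
    {k : Ω → Ω → ℝ} (hk : Measurable (Function.uncurry k)) {κ F : ℝ} (hκ : ∀ y x, |k y x| ≤ κ)
    {w : (Fin n → Ω) × (Fin n → Ω) → Ω → ℝ} (hw : Measurable (Function.uncurry w))
    (hwF : ∀ D x, |w D x| ≤ F) :
    Integrable (fun D : (Fin n → Ω) × (Fin n → Ω) =>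
      sampleMean (fun x => (sampleMean (fun y => k y x) D.2 - w D x) ^ 2) D.1)
      ((Measure.pi fun _ => μ).prod (Measure.pi fun _ => μ)) := by
  obtain ⟨x₀⟩ : Nonempty Ω := nonempty_of_isProbabilityMeasure μ
  have hκ0 : 0 ≤ κ := (abs_nonneg _).trans (hκ x₀ x₀)
  refine integrable_of_abs_le ?_ (C := (κ + F) ^ 2) fun D =>
    abs_sampleMean_le (by positivity) (fun x => abs_sq_le_sq_of_abs_le ?_) D.1
  · refine measurable_sampleMean (ψ := fun (D : (Fin n → Ω) × (Fin n → Ω)) x =>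
      (sampleMean (fun y => k y x) D.2 - w D x) ^ 2) ?_ measurable_fst
    refine Measurable.pow_const (Measurable.sub ?_ hw) 2
    exact (measurable_kernelMean hk).comp
      ((measurable_snd.comp measurable_fst).prodMk measurable_snd)
  · exact (abs_sub _ _).trans (add_le_add (abs_sampleMean_le hκ0 (fun y => hκ y x) D.2)
      (hwF D x))

/-- Oracle inequality for least squares with a kernel average as response. -/
theorem integral_risk_le {μ : Measure Ω} [IsProbabilityMeasure μ] {n : ℕ} (hn : 0 < n)
    {k : Ω → Ω → ℝ} (hk : Measurable (Function.uncurry k)) {κ A B F b L δ : ℝ}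
    (hκ : ∀ y x, |k y x| ≤ κ) (hA : 0 < A)
    (hA1 : ∀ x, ∫ y, |k y x| ∂μ ≤ A) (hA2 : ∀ y, ∫ x, |k y x| ∂μ ≤ A)
    {f₀ : Ω → ℝ} (hf₀ : Measurable f₀) (hf₀F : ∀ x, |f₀ x| ≤ F)
    (hb : ∀ x, |∫ y, k y x ∂μ - f₀ x| ≤ b)
    {G : Set (Fin n → Ω)} (hG : MeasurableSet G)
    (hGB : ∀ X' ∈ G, ∀ x, |sampleMean (fun y => k y x) X'| ≤ B)
    (hL0 : 0 < L) (hL1 : 12 * (2 * B + 4 * F) * F ≤ L) (hL2 : 24 * F * A ≤ L)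
    (hL3 : 36 * (2 * B + 4 * F) ^ 2 + 144 * A ^ 2 ≤ 2 * L)
    {u : (Fin n → Ω) × (Fin n → Ω) → Ω → ℝ} (hu : Measurable (Function.uncurry u))
    (huF : ∀ D x, |u D x| ≤ F) {ι : Type*} [Fintype ι] [Nonempty ι] {f : ι → Ω → ℝ}
    (hf : ∀ j, Measurable (f j)) (hfF : ∀ j x, |f j x| ≤ F) (hδ0 : 0 ≤ δ)
    (hcov : ∀ D, ∃ j, ∀ x, |u D x - f j x| ≤ δ)
    {v : Ω → ℝ} (hv : Measurable v) (hvF : ∀ x, |v x| ≤ F) :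
    ∫ D, ∫ x, (u D x - f₀ x) ^ 2 ∂μ ∂(Measure.pi fun _ => μ).prod (Measure.pi fun _ => μ) ≤
    6 * ∫ D : (Fin n → Ω) × (Fin n → Ω),
      (sampleMean (fun x => (sampleMean (fun y => k y x) D.2 - u D x) ^ 2) D.1 -
       sampleMean (fun x => (sampleMean (fun y => k y x) D.2 - v x) ^ 2) D.1)
      ∂(Measure.pi fun _ => μ).prod (Measure.pi fun _ => μ) +
    7 * ∫ x, (v x - f₀ x) ^ 2 ∂μ + δ * (28 * F + 12 * (A + F)) + 48 * b ^ 2 +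
    L / n * (Real.log (Fintype.card ι) + 1) +
      (4 * F ^ 2 + 24 * F * (κ + F)) * (Measure.pi fun _ : Fin n => μ).real Gᶜ := by
  obtain ⟨x₀⟩ : Nonempty Ω := nonempty_of_isProbabilityMeasure μ
  have hκ0 : 0 ≤ κ := (abs_nonneg _).trans (hκ x₀ x₀)
  have hF0 : 0 ≤ F := (abs_nonneg _).trans (hf₀F x₀)
  obtain ⟨hWi, hW⟩ := integral_risk_add_gain_le hn hk hκ hA hA1 hA2 hf₀ hf₀F hb hG hGB hL0 hL1 hL2
    hL3 hu huF hf hfF hδ0 hcov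
  obtain ⟨hΦi, hΦ⟩ := integral_comparison_le (n := n) hn hk hκ hf₀ hf₀F hv hvF hb
  have hlu := integrable_sampleMean_sq_sub (μ := μ) hk hκ hu huF
  have hlv := integrable_sampleMean_sq_sub (μ := μ) (n := n) (w := fun _ => v) hk hκ
    (hv.comp measurable_snd) (fun _ => hvF)
  -- The exact decomposition behind the proof: pointwise (k̄ - f)² = (k̄ - f₀)² - gain of f - f₀,
  -- used for u and for v. The last summand is minus the gain of v - f₀.
  have hid : ∀ D : (Fin n → Ω) × (Fin n → Ω), ∫ x, (u D x - f₀ x) ^ 2 ∂μ =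
      (∫ x, (u D x - f₀ x) ^ 2 ∂μ + 6 * sampleMean (gain k f₀ (fun x => u D x - f₀ x) D.2) D.1) +
      6 * (sampleMean (fun x => (sampleMean (fun y => k y x) D.2 - u D x) ^ 2) D.1 -
       sampleMean (fun x => (sampleMean (fun y => k y x) D.2 - v x) ^ 2) D.1) +
      6 * sampleMean (fun x => sampleMean
        (fun y => (v x - f₀ x) ^ 2 - 2 * (k y x - f₀ x) * (v x - f₀ x)) D.2) D.1 := fun D => by
    have h1 : ∀ x, sampleMean (fun y => (v x - f₀ x) ^ 2 - 2 * (k y x - f₀ x) * (v x - f₀ x)) D.2 =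
        (v x - f₀ x) ^ 2 - 2 * (sampleMean (fun y => k y x) D.2 - f₀ x) * (v x - f₀ x) :=
        fun x => by
      have e : (fun y => (v x - f₀ x) ^ 2 - 2 * (k y x - f₀ x) * (v x - f₀ x)) = fun y =>
          (v x - f₀ x) ^ 2 - (2 * (v x - f₀ x)) * (k y x - f₀ x) := by
        funext y; ring
      rw [e, sampleMean_sub, sampleMean_const hn, sampleMean_const_mul, sampleMean_sub,
        sampleMean_const hn]
      ring
    have h2 : sampleMean (gain k f₀ (fun x => u D x - f₀ x) D.2) D.1 +
      (sampleMean (fun x => (sampleMean (fun y => k y x) D.2 - u D x) ^ 2) D.1 -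
       sampleMean (fun x => (sampleMean (fun y => k y x) D.2 - v x) ^ 2) D.1) +
      sampleMean (fun x => sampleMean
        (fun y => (v x - f₀ x) ^ 2 - 2 * (k y x - f₀ x) * (v x - f₀ x)) D.2) D.1 = 0 := by
      rw [← sampleMean_sub, ← sampleMean_add, ← sampleMean_add, ← sampleMean_const hn 0 D.1]
      congr 1
      funext x
      rw [h1]
      unfold gain
      ring
    linarith
  have hsum : ∫ D, ∫ x, (u D x - f₀ x) ^ 2 ∂μ
        ∂(Measure.pi fun _ => μ).prod (Measure.pi fun _ => μ) =
      ∫ D, (∫ x, (u D x - f₀ x) ^ 2 ∂μ +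
        6 * sampleMean (gain k f₀ (fun x => u D x - f₀ x) D.2) D.1)
        ∂(Measure.pi fun _ => μ).prod (Measure.pi fun _ => μ) +
      6 * ∫ D : (Fin n → Ω) × (Fin n → Ω),
        (sampleMean (fun x => (sampleMean (fun y => k y x) D.2 - u D x) ^ 2) D.1 -
         sampleMean (fun x => (sampleMean (fun y => k y x) D.2 - v x) ^ 2) D.1)
        ∂(Measure.pi fun _ => μ).prod (Measure.pi fun _ => μ) +
      6 * ∫ D : (Fin n → Ω) × (Fin n → Ω), sampleMean (fun x => sampleMean
        (fun y => (v x - f₀ x) ^ 2 - 2 * (k y x - f₀ x) * (v x - f₀ x)) D.2) D.1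
        ∂(Measure.pi fun _ => μ).prod (Measure.pi fun _ => μ) := by
    exact integral_eq_add_const_mul_add hWi (hlu.sub hlv) hΦi hid
  rw [hsum]
  linarith

end Abstract

/-! ### Taylor approximation of Hölder functions along coordinate lines -/

section Taylor

/-- Induction on s: integrate the polynomial that approximates φ' and apply the mean value
inequality on the segment from 0 to t, gaining one factor |t|. The coefficients are never needed
explicitly. -/
theorem exists_abs_sub_polynomial_le {s : ℕ} {α Q : ℝ} (hα : 0 < α) (hQ : 0 ≤ Q) {φ : ℝ → ℝ}
    (hφ : ContDiff ℝ s φ)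
    (hH : ∀ t, |iteratedDeriv s φ t - iteratedDeriv s φ 0| ≤ Q * |t| ^ α) :
    ∃ c : ℕ → ℝ, ∀ t, |φ t - ∑ k ∈ Finset.range (s + 1), c k * t ^ k| ≤ Q * |t| ^ (s + α) := by
  induction s generalizing φ with
  | zero => exact ⟨fun _ => φ 0, fun t => by simpa using hH t⟩
  | succ s ih =>
    have hφ' : ContDiff ℝ s (deriv φ) := by
      have h1 : ContDiff ℝ (s + 1) φ := by exact_mod_cast hφ
      exact (contDiff_succ_iff_deriv.1 h1).2.2
    have hd : Differentiable ℝ φ := hφ.differentiable (by simp)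
    simp_rw [iteratedDeriv_succ'] at hH
    obtain ⟨c, hc⟩ := ih hφ' hH
    refine ⟨fun k => Nat.casesOn k (φ 0) fun j => c j / (j + 1), fun t => ?_⟩
    have hsum : ∀ t : ℝ, ∑ k ∈ Finset.range (s + 1 + 1),
        (Nat.casesOn k (φ 0) fun j => c j / (j + 1) : ℝ) * t ^ k =
        ∑ k ∈ Finset.range (s + 1), c k / (k + 1) * t ^ (k + 1) + φ 0 := fun t => by
      rw [Finset.sum_range_succ']; simp
    rw [hsum]
    have hder : ∀ t, HasDerivAt (fun t => φ t -
        (∑ k ∈ Finset.range (s + 1), c k / (k + 1) * t ^ (k + 1) + φ 0))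
        (deriv φ t - ∑ k ∈ Finset.range (s + 1), c k * t ^ k) t := fun t => by
      refine (hd t).hasDerivAt.sub (HasDerivAt.add_const _ (HasDerivAt.fun_sum fun k _ => ?_))
      have h1 := (hasDerivAt_pow (k + 1) t).const_mul (c k / (k + 1))
      have h2 : c k / (k + 1) * (((k + 1 : ℕ) : ℝ) * t ^ (k + 1 - 1)) = c k * t ^ k := by
        have : (k : ℝ) + 1 ≠ 0 := by positivity
        push_cast
        field_simp
      rwa [h2] at h1
    have hmv := (convex_uIcc (0 : ℝ) t).norm_image_sub_le_of_norm_hasDerivWithin_le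
      (f := fun t => φ t - (∑ k ∈ Finset.range (s + 1), c k / (k + 1) * t ^ (k + 1) + φ 0))
      (C := Q * |t| ^ (s + α)) (fun x _ => (hder x).hasDerivWithinAt) (fun x hx => ?_)
      Set.left_mem_uIcc Set.right_mem_uIcc
    · have h0 : φ 0 - (∑ k ∈ Finset.range (s + 1), c k / (k + 1) * (0 : ℝ) ^ (k + 1) + φ 0) =
          0 := by
        simp
      rw [h0, sub_zero, sub_zero, Real.norm_eq_abs, Real.norm_eq_abs] at hmv
      refine hmv.trans (le_of_eq ?_)
      have hs : (s : ℝ) + α ≠ 0 := by positivity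
      have : ((s + 1 : ℕ) : ℝ) + α = (s + α) + 1 := by push_cast; ring
      rw [this, Real.rpow_add_one' (abs_nonneg t) (by positivity)]
      ring
    · refine (hc x).trans ?_
      have : |x| ≤ |t| := by simpa using Set.abs_sub_left_of_mem_uIcc hx
      gcongr

/-- Along each coordinate direction, `g` is within `Q |t|^β` of a polynomial of degree `≤ s`. -/
def CoordPolyApprox (s : ℕ) (β Q : ℝ) {d : ℕ} (g : (Fin d → ℝ) → ℝ) : Prop :=
  ∀ (r : Fin d) (y : Fin d → ℝ), ∃ c : ℕ → ℝ, ∀ t : ℝ,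
    |g (y + t • Pi.single r 1) - ∑ k ∈ Finset.range (s + 1), c k * t ^ k| ≤ Q * |t| ^ β

theorem deriv_comp_line {d : ℕ} (g : (Fin d → ℝ) → ℝ) (y : Fin d → ℝ) (r : Fin d) :
    deriv (fun t : ℝ => g (y + t • Pi.single r 1)) =
      fun t => partialDeriv r g (y + t • Pi.single r 1) := by
  funext t
  unfold partialDeriv lineDeriv
  have h := deriv_comp_const_add (fun τ : ℝ => g (y + τ • Pi.single r 1)) t 0
  rw [add_zero] at h
  rw [← h]
  congr 1
  funext τ
  rw [add_smul, add_assoc]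

theorem iteratedDeriv_comp_line {d : ℕ} (s : ℕ) (g : (Fin d → ℝ) → ℝ) (y : Fin d → ℝ)
    (r : Fin d) :
    iteratedDeriv s (fun t : ℝ => g (y + t • Pi.single r 1)) =
      fun t => (partialDeriv r)^[s] g (y + t • Pi.single r 1) := by
  induction s generalizing g with
  | zero => simp
  | succ s ih => rw [iteratedDeriv_succ', deriv_comp_line, ih, Function.iterate_succ_apply]

/-- Restricting g to a coordinate line involves only pure derivatives, so at top order these are the
multi-indices whose Hölder bound is used. -/
theorem multiDeriv_single {d : ℕ} (r : Fin d) (s : ℕ) (g : (Fin d → ℝ) → ℝ) :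
    multiDeriv (Pi.single r s) g = (partialDeriv r)^[s] g := by
  have h : ∀ l : List (Fin d), l.Nodup →
      l.foldr (fun i u => (partialDeriv i)^[(Pi.single r s : Fin d → ℕ) i] u) g =
        if r ∈ l then (partialDeriv r)^[s] g else g := fun l => by
    induction l with
    | nil => simp
    | cons a l ih =>
      intro hl
      rw [List.nodup_cons] at hl
      rw [List.foldr_cons, ih hl.2]
      by_cases har : a = r
      · subst har
        simp [hl.1]
      · have : r ≠ a := fun h => har h.symm
        simp [this]
  rw [multiDeriv, h _ (List.nodup_finRange d)]
  simp

theorem multiDeriv_zero {d : ℕ} (g : (Fin d → ℝ) → ℝ) : multiDeriv 0 g = g := by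
  unfold multiDeriv
  induction List.finRange d with
  | nil => rfl
  | cons a l ih => simp

theorem floorLt_lt {β : ℝ} (hβ : 0 < β) : (floorLt β : ℝ) < β := by
  have h1 : 0 < ⌈β⌉₊ := Nat.ceil_pos.2 hβ
  have h2 := Nat.ceil_lt_add_one hβ.le
  unfold floorLt
  rw [Nat.cast_sub h1]
  push_cast
  linarith

theorem abs_le_of_holderNorm_le {d : ℕ} {β Q : ℝ} {g : (Fin d → ℝ) → ℝ} (hQ : 0 ≤ Q)
    (hg : holderNorm β g ≤ ENNReal.ofReal Q) (x : Fin d → ℝ) : |g x| ≤ Q := by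
  have h1 : ‖g x‖ₑ ≤ ENNReal.ofReal Q := by
    calc ‖g x‖ₑ = ‖multiDeriv 0 g x‖ₑ := by rw [multiDeriv_zero]
      _ ≤ ⨆ x, ‖multiDeriv 0 g x‖ₑ := le_iSup (fun x => ‖multiDeriv 0 g x‖ₑ) x
      _ ≤ ∑ γ ∈ Finset.piAntidiag (Finset.univ : Finset (Fin d)) 0, ⨆ x, ‖multiDeriv γ g x‖ₑ :=
        Finset.single_le_sum (f := fun γ : Fin d → ℕ => ⨆ x, ‖multiDeriv γ g x‖ₑ)
          (fun _ _ => zero_le) (by simp)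
      _ ≤ ∑ m ∈ Finset.range (floorLt β + 1),
          ∑ γ ∈ Finset.piAntidiag (Finset.univ : Finset (Fin d)) m,
          ⨆ x, ‖multiDeriv γ g x‖ₑ :=
        Finset.single_le_sum (f := fun m =>
          ∑ γ ∈ Finset.piAntidiag (Finset.univ : Finset (Fin d)) m,
          ⨆ x, ‖multiDeriv γ g x‖ₑ) (fun _ _ => zero_le) (by simp)
      _ ≤ holderNorm β g := le_self_add
      _ ≤ _ := hg
  rw [← ofReal_norm] at h1
  exact (ENNReal.ofReal_le_ofReal_iff hQ).1 h1

theorem abs_multiDeriv_sub_le {d : ℕ} {β Q : ℝ} {g : (Fin d → ℝ) → ℝ} (hQ : 0 ≤ Q) (hβ : 0 < β)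
    (hg : holderNorm β g ≤ ENNReal.ofReal Q) {γ : Fin d → ℕ} (hγ : ∑ i, γ i = floorLt β)
    (x y : Fin d → ℝ) :
    |multiDeriv γ g x - multiDeriv γ g y| ≤ Q * dist x y ^ (β - floorLt β) := by
  have hα : 0 < β - floorLt β := sub_pos.2 (floorLt_lt hβ)
  rcases eq_or_ne x y with rfl | hxy
  · simp [Real.zero_rpow hα.ne']
  have h1 : ‖multiDeriv γ g x - multiDeriv γ g y‖ₑ / edist x y ^ (β - (floorLt β : ℝ)) ≤
      ENNReal.ofReal Q := by
    calc _ ≤ ⨆ (x : Fin d → ℝ) (y : Fin d → ℝ) (_ : x ≠ y),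
          ‖multiDeriv γ g x - multiDeriv γ g y‖ₑ / edist x y ^ (β - (floorLt β : ℝ)) :=
          le_iSup_of_le x (le_iSup_of_le y (le_iSup_of_le hxy le_rfl))
      _ ≤ ∑ γ ∈ Finset.piAntidiag (Finset.univ : Finset (Fin d)) (floorLt β),
          ⨆ (x : Fin d → ℝ) (y : Fin d → ℝ) (_ : x ≠ y),
          ‖multiDeriv γ g x - multiDeriv γ g y‖ₑ / edist x y ^ (β - (floorLt β : ℝ)) :=
          Finset.single_le_sum (f := fun γ : Fin d → ℕ =>
            ⨆ (x : Fin d → ℝ) (y : Fin d → ℝ) (_ : x ≠ y),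
            ‖multiDeriv γ g x - multiDeriv γ g y‖ₑ / edist x y ^ (β - (floorLt β : ℝ)))
            (fun _ _ => zero_le) (by simp [hγ])
      _ ≤ holderNorm β g := le_add_self
      _ ≤ _ := hg
  have hd : 0 < dist x y := dist_pos.2 hxy
  rw [edist_dist, ENNReal.ofReal_rpow_of_pos hd, ENNReal.div_le_iff
    (by simpa using Real.rpow_pos_of_pos hd _) ENNReal.ofReal_ne_top, ← ENNReal.ofReal_mul hQ,
    ← ofReal_norm, ENNReal.ofReal_le_ofReal_iff (by positivity)] at h1
  exact h1

theorem coordPolyApprox_of_mem_holderBall {d : ℕ} {β Q : ℝ} (hβ : 0 < β) (hQ : 0 ≤ Q)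
    {g : (Fin d → ℝ) → ℝ} (hg : g ∈ HolderBall d β Q) : CoordPolyApprox (floorLt β) β Q g := by
  intro r y
  have hα : 0 < β - floorLt β := sub_pos.2 (floorLt_lt hβ)
  have hline : ContDiff ℝ (floorLt β : ℕ) fun t : ℝ => g (y + t • Pi.single r 1) :=
    hg.1.comp (contDiff_const.add (contDiff_id.smul contDiff_const))
  obtain ⟨c, hc⟩ := exists_abs_sub_polynomial_le hα hQ hline fun t => by
    rw [iteratedDeriv_comp_line, ← multiDeriv_single]
    refine (abs_multiDeriv_sub_le hQ hβ hg.2 (by simp) _ _).trans (le_of_eq ?_)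
    have h1 : ‖(Pi.single r 1 : Fin d → ℝ)‖ = 1 := by rw [Pi.norm_single, norm_one]
    rw [dist_eq_norm, zero_smul, add_zero, add_sub_cancel_left, norm_smul, h1, mul_one,
      Real.norm_eq_abs]
  refine ⟨c, fun t => ?_⟩
  have := hc t
  rwa [add_sub_cancel] at this

end Taylor

/-! ### Bias of kernel smoothing -/

section Bias

theorem one_le_integral_abs_kernel {K : ℝ → ℝ} {s : ℕ} (hK : IsKernelOfOrder K s) :
    1 ≤ ∫ u, |K u| := by
  have h := abs_integral_le_integral_abs (μ := volume) (f := K)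
  rwa [hK.integral_eq_one, abs_one] at h

theorem integrable_pow_mul_kernel {K : ℝ → ℝ} (hK : Integrable K)
    (hsupp : Function.support K ⊆ Set.Icc (-1) 1) (l : ℕ) :
    Integrable fun u => u ^ l * K u := by
  refine hK.mono ((measurable_id.pow_const l).aestronglyMeasurable.mul hK.1)
    (ae_of_all _ fun u => ?_)
  rw [norm_mul]
  by_cases hu : K u = 0
  · simp [hu]
  · have h1 : |u| ≤ 1 := abs_le.2 (hsupp hu)
    refine mul_le_of_le_one_left (norm_nonneg _) ?_
    rw [Real.norm_eq_abs, abs_pow]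
    exact pow_le_one₀ (abs_nonneg _) h1

theorem integrable_kernel_mul_bounded {K φ : ℝ → ℝ} (hK : Integrable K) (hφ : Measurable φ)
    {c : ℝ} (hc : ∀ u, |φ u| ≤ c) : Integrable fun u => K u * φ u :=
  hK.mul_bdd (c := c) hφ.aestronglyMeasurable (ae_of_all _ hc)

/-- The bias of kernel smoothing in one variable. -/
theorem abs_integral_kernel_mul_sub_le {K : ℝ → ℝ} {s : ℕ} (hK : IsKernelOfOrder K s)
    (hsupp : Function.support K ⊆ Set.Icc (-1) 1) {β Q h : ℝ} (hβ : 0 < β) (hQ : 0 ≤ Q) (hh : 0 ≤ h)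
    {φ : ℝ → ℝ} (hφ : Measurable φ) {B : ℝ} (hB : ∀ t, |φ t| ≤ B) {c : ℕ → ℝ}
    (hc : ∀ t, |φ t - ∑ k ∈ Finset.range (s + 1), c k * t ^ k| ≤ Q * |t| ^ β) :
    |(∫ u, K u * φ (h * u)) - φ 0| ≤ Q * h ^ β * ∫ u, |K u| := by
  -- At t = 0 the error bound is Q · 0^β = 0, so the constant coefficient is forced.
  have h0 : φ 0 = c 0 := by
    have h1 := hc 0
    rw [abs_zero, Real.zero_rpow hβ.ne', mul_zero, Finset.sum_range_succ'] at h1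
    simpa [sub_eq_zero] using h1
  have hi1 : Integrable fun u => K u * φ (h * u) :=
    integrable_kernel_mul_bounded hK.integrable (hφ.comp (measurable_const.mul measurable_id))
      fun u => hB _
  have hi2 : ∀ k, Integrable fun u => c k * h ^ k * (u ^ k * K u) := fun k =>
    (integrable_pow_mul_kernel hK.integrable hsupp k).const_mul _
  have hi3 : Integrable fun u => ∑ k ∈ Finset.range (s + 1), c k * h ^ k * (u ^ k * K u) :=
    integrable_finsetSum _ fun k _ => hi2 k
  have hpoly : ∫ u, ∑ k ∈ Finset.range (s + 1), c k * h ^ k * (u ^ k * K u) = φ 0 := by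
    rw [integral_finsetSum _ fun k _ => hi2 k, Finset.sum_range_succ', h0]
    have hz : ∑ k ∈ Finset.range s, ∫ u, c (k + 1) * h ^ (k + 1) * (u ^ (k + 1) * K u) = 0 := by
      refine Finset.sum_eq_zero fun k hk => ?_
      rw [integral_const_mul, hK.moment_eq_zero (k + 1) (by omega)
        (by have := Finset.mem_range.1 hk; omega), mul_zero]
    rw [hz, integral_const_mul]
    simp [hK.integral_eq_one]
  have he : (∫ u, K u * φ (h * u)) - φ 0 = ∫ u, (K u * φ (h * u) -
      ∑ k ∈ Finset.range (s + 1), c k * h ^ k * (u ^ k * K u)) := by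
    rw [integral_sub hi1 hi3, hpoly]
  rw [he, ← integral_const_mul]
  refine (Real.norm_eq_abs _).symm.le.trans
    (norm_integral_le_of_norm_le (hK.integrable.abs.const_mul _) (ae_of_all _ fun u => ?_))
  have e : K u * φ (h * u) - ∑ k ∈ Finset.range (s + 1), c k * h ^ k * (u ^ k * K u) =
      K u * (φ (h * u) - ∑ k ∈ Finset.range (s + 1), c k * (h * u) ^ k) := by
    rw [mul_sub, Finset.mul_sum]
    congr 1
    exact Finset.sum_congr rfl fun k _ => by rw [mul_pow]; ring
  rw [e, Real.norm_eq_abs, abs_mul, mul_comm]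
  by_cases hu : K u = 0
  · simp [hu]
  -- Where K does not vanish, |u| ≤ 1, so the approximation error at hu is at most Q h^β.
  · refine mul_le_mul_of_nonneg_right ((hc _).trans ?_) (abs_nonneg _)
    have h1 : |u| ≤ 1 := abs_le.2 (hsupp hu)
    refine mul_le_mul_of_nonneg_left (Real.rpow_le_rpow (abs_nonneg _) ?_ hβ.le) hQ
    rw [abs_mul, abs_of_nonneg hh]
    exact mul_le_of_le_one_right hh h1

theorem cons_eq_piFinSuccAbove_symm (d : ℕ) :
    (fun p : ℝ × (Fin d → ℝ) => (Fin.cons p.1 p.2 : Fin (d + 1) → ℝ)) =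
      (MeasurableEquiv.piFinSuccAbove (fun _ : Fin (d + 1) => ℝ) 0).symm := by
  funext p
  exact (Fin.insertNth_zero' p.1 p.2).symm

theorem measurePreserving_cons (d : ℕ) : MeasurePreserving
    (fun p : ℝ × (Fin d → ℝ) => (Fin.cons p.1 p.2 : Fin (d + 1) → ℝ)) := by
  rw [cons_eq_piFinSuccAbove_symm]
  exact (volume_preserving_piFinSuccAbove (fun _ : Fin (d + 1) => ℝ) 0).symm

theorem measurable_cons {α : Type*} [MeasurableSpace α] {d : ℕ} {a : α → ℝ} {b : α → Fin d → ℝ}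
    (ha : Measurable a) (hb : Measurable b) :
    Measurable fun z => (Fin.cons (a z) (b z) : Fin (d + 1) → ℝ) :=
  (measurePreserving_cons d).measurable.comp (ha.prodMk hb)

/-- The bias of smoothing with a product kernel. -/
theorem abs_integral_prod_kernel_mul_sub_le {K : ℝ → ℝ} {s : ℕ} (hK : IsKernelOfOrder K s)
    (hsupp : Function.support K ⊆ Set.Icc (-1) 1) {β Q h : ℝ} (hβ : 0 < β) (hQ : 0 ≤ Q) (hh : 0 ≤ h)
    {d : ℕ} {g : (Fin d → ℝ) → ℝ} (hg : Measurable g) {B : ℝ} (hB : ∀ t, |g t| ≤ B)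
    (hpoly : CoordPolyApprox s β Q g) (x : Fin d → ℝ) :
    |(∫ u : Fin d → ℝ, (∏ r, K (u r)) * g (x + h • u)) - g x| ≤
      d * (∫ u, |K u|) ^ d * (Q * h ^ β) := by
  have hC1 := one_le_integral_abs_kernel hK
  set C := ∫ u, |K u| with hC
  induction d with
  | zero =>
    have h1 : ∀ u : Fin 0 → ℝ, x + h • u = x := fun u => Subsingleton.elim _ _
    simp only [Finset.univ_eq_empty, Finset.prod_empty, one_mul, h1, Nat.cast_zero, zero_mul]
    have h2 : (volume : Measure (Fin 0 → ℝ)).real Set.univ = 1 := by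
      rw [volume_pi, Measure.pi_of_empty]; simp
    rw [integral_const, h2]
    simp
  | succ d ih =>
    have hcons : ∀ (t : ℝ) (u : Fin d → ℝ), x + h • (Fin.cons t u : Fin (d + 1) → ℝ) =
        Fin.cons (x 0 + h * t) (Fin.tail x + h • u) := fun t u => by
      funext i
      refine Fin.cases ?_ (fun i => ?_) i <;> simp [Fin.tail]
    have hmg : Measurable fun p : ℝ × (Fin d → ℝ) =>
        g (Fin.cons (x 0 + h * p.1) (Fin.tail x + h • p.2)) := by
      refine hg.comp (measurable_cons ?_ ?_) <;> fun_prop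
    have hint : Integrable fun p : ℝ × (Fin d → ℝ) => (K p.1 * ∏ r, K (p.2 r)) *
        g (Fin.cons (x 0 + h * p.1) (Fin.tail x + h • p.2)) := by
      refine Integrable.mul_bdd (c := B) ?_ hmg.aestronglyMeasurable (ae_of_all _ fun p => hB _)
      exact hK.integrable.mul_prod
        (Integrable.fintype_prod (f := fun _ : Fin d => K) fun _ => hK.integrable)
    have hfub : ∫ u : Fin (d + 1) → ℝ, (∏ r, K (u r)) * g (x + h • u) =
        ∫ t, ∫ u : Fin d → ℝ, (K t * ∏ r, K (u r)) *
          g (Fin.cons (x 0 + h * t) (Fin.tail x + h • u)) := by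
      have hemb : MeasurableEmbedding
          fun p : ℝ × (Fin d → ℝ) => (Fin.cons p.1 p.2 : Fin (d + 1) → ℝ) := by
        rw [cons_eq_piFinSuccAbove_symm]
        exact (MeasurableEquiv.piFinSuccAbove _ 0).symm.measurableEmbedding
      rw [← integral_prod (fun p : ℝ × (Fin d → ℝ) => (K p.1 * ∏ r, K (p.2 r)) *
        g (Fin.cons (x 0 + h * p.1) (Fin.tail x + h • p.2))) hint,
        ← (measurePreserving_cons d).integral_comp hemb]
      refine integral_congr_ae (ae_of_all _ fun p => ?_)
      simp only [hcons, Fin.prod_univ_succ, Fin.cons_zero, Fin.cons_succ]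
    -- Smooth the last d coordinates with the first one frozen: a slice of g satisfies the same
    -- coordinatewise approximation. The first coordinate is then treated by the one-variable lemma,
    -- so no mixed derivative appears.
    have hinner : ∀ t, |(∫ u : Fin d → ℝ, (∏ r, K (u r)) *
        g (Fin.cons (x 0 + h * t) (Fin.tail x + h • u))) -
        g (Fin.cons (x 0 + h * t) (Fin.tail x))| ≤ d * C ^ d * (Q * h ^ β) := fun t => by
      refine ih (g := fun z => g (Fin.cons (x 0 + h * t) z)) ?_ (fun z => hB _) ?_ (Fin.tail x)
      · exact hg.comp (measurable_cons measurable_const measurable_id)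
      · intro r y
        obtain ⟨c, hc⟩ := hpoly r.succ (Fin.cons (x 0 + h * t) y)
        refine ⟨c, fun τ => ?_⟩
        convert hc τ using 5
        funext i
        refine Fin.cases ?_ (fun i => ?_) i
        · simp
        · simp [Pi.single_apply]
    have hline : ∀ τ : ℝ, g (Fin.cons (x 0 + τ) (Fin.tail x)) = g (x + τ • Pi.single 0 1) :=
      fun τ => by
        congr 1
        funext i
        refine Fin.cases ?_ (fun i => ?_) i <;> simp [Fin.tail]
    obtain ⟨c, hc⟩ := hpoly 0 x
    have hφm : Measurable fun τ : ℝ => g (Fin.cons (x 0 + τ) (Fin.tail x)) := by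
      refine hg.comp (measurable_cons ?_ ?_) <;> fun_prop
    have houter := abs_integral_kernel_mul_sub_le hK hsupp hβ hQ hh hφm (fun t => hB _)
      (c := c) (fun t => by rw [hline]; exact hc t)
    have hi1 : Integrable fun t => K t * ∫ u : Fin d → ℝ, (∏ r, K (u r)) *
        g (Fin.cons (x 0 + h * t) (Fin.tail x + h • u)) := by
      have := hint.integral_prod_left
      simpa only [mul_assoc, integral_const_mul] using this
    have hi2 : Integrable fun t => K t * g (Fin.cons (x 0 + h * t) (Fin.tail x)) :=
      integrable_kernel_mul_bounded hK.integrable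
        (hφm.comp (measurable_const.mul measurable_id)) fun t => hB _
    have h0 : (Fin.cons (x 0 + 0) (Fin.tail x) : Fin (d + 1) → ℝ) = x := by
      rw [add_zero, Fin.cons_self_tail]
    rw [h0] at houter
    simp only [mul_assoc, integral_const_mul] at hfub
    have hfirst : |(∫ t, K t * ∫ u : Fin d → ℝ, (∏ r, K (u r)) *
        g (Fin.cons (x 0 + h * t) (Fin.tail x + h • u))) -
        ∫ t, K t * g (Fin.cons (x 0 + h * t) (Fin.tail x))| ≤ d * C ^ d * (Q * h ^ β) * C := by
      rw [← integral_sub hi1 hi2, hC, ← integral_const_mul]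
      refine (Real.norm_eq_abs _).symm.le.trans
        (norm_integral_le_of_norm_le (hK.integrable.abs.const_mul _) (ae_of_all _ fun t => ?_))
      rw [← mul_sub, Real.norm_eq_abs, abs_mul, mul_comm]
      exact mul_le_mul_of_nonneg_right (hinner t) (abs_nonneg _)
    -- C ≥ 1 because ∫ K = 1; this lets the new error C be counted as one more copy of C^(d+1).
    have hCd : C ≤ C ^ (d + 1) := le_self_pow₀ hC1 (by omega)
    have hQh : 0 ≤ Q * h ^ β := by positivity
    rw [hfub]
    push_cast
    calc _ ≤ d * C ^ d * (Q * h ^ β) * C + Q * h ^ β * C := by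
          refine (abs_sub_le _ (∫ t, K t * g (Fin.cons (x 0 + h * t) (Fin.tail x))) _).trans
            (add_le_add hfirst houter)
      _ = d * C ^ (d + 1) * (Q * h ^ β) + Q * h ^ β * C := by ring
      _ ≤ d * C ^ (d + 1) * (Q * h ^ β) + Q * h ^ β * C ^ (d + 1) := by gcongr
      _ = _ := by ring

end Bias

/-! ### The rescaled product kernel -/

section Kernel

/-- The product kernel with bandwidth `h`. -/
noncomputable def prodKernel (K : ℝ → ℝ) (h : ℝ) {d : ℕ} (y x : Fin d → ℝ) : ℝ :=
  1 / h ^ d * ∏ r, K ((y r - x r) / h)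

theorem measurable_prodKernel {K : ℝ → ℝ} (hK : Measurable K) (h : ℝ) (d : ℕ) :
    Measurable (Function.uncurry (prodKernel K h (d := d))) := by
  refine measurable_const.mul (Finset.measurable_prod _ fun r _ => hK.comp ?_)
  fun_prop

theorem abs_prodKernel {K : ℝ → ℝ} {h : ℝ} (hh : 0 < h) {d : ℕ} (y x : Fin d → ℝ) :
    |prodKernel K h y x| = prodKernel (fun u => |K u|) h y x := by
  unfold prodKernel
  rw [abs_mul, Finset.abs_prod, abs_of_pos (by positivity)]

theorem prodKernel_swap (K : ℝ → ℝ) (h : ℝ) {d : ℕ} (y x : Fin d → ℝ) :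
    prodKernel K h y x = prodKernel (fun u => K (-u)) h x y := by
  unfold prodKernel
  congr 1
  refine Finset.prod_congr rfl fun r _ => ?_
  congr 1
  ring

theorem abs_prodKernel_le {K : ℝ → ℝ} {M : ℝ} (hM : ∀ u, |K u| ≤ M) {h : ℝ} (hh : 0 < h) {d : ℕ}
    (y x : Fin d → ℝ) : |prodKernel K h y x| ≤ 1 / h ^ d * M ^ d := by
  rw [abs_prodKernel hh, prodKernel]
  refine mul_le_mul_of_nonneg_left ?_ (by positivity)
  refine (Finset.prod_le_prod (fun r _ => abs_nonneg _) fun r _ => hM _).trans ?_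
  simp

theorem prodKernel_eq_zero {K : ℝ → ℝ} (hsupp : Function.support K ⊆ Set.Icc (-1) 1) {h : ℝ}
    (hh : 0 < h) {d : ℕ} {y x : Fin d → ℝ} {r : Fin d} (hr : h < |y r - x r|) :
    prodKernel K h y x = 0 := by
  unfold prodKernel
  rw [Finset.prod_eq_zero (Finset.mem_univ r), mul_zero]
  by_contra hne
  have h1 : |(y r - x r) / h| ≤ 1 := abs_le.2 (hsupp hne)
  rw [abs_div, abs_of_pos hh, div_le_one hh] at h1
  exact absurd hr h1.not_gt

theorem integral_prodKernel_mul {K : ℝ → ℝ} {h : ℝ} (hh : 0 < h) {d : ℕ} (φ : (Fin d → ℝ) → ℝ)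
    (x : Fin d → ℝ) :
    ∫ y, prodKernel K h y x * φ y = ∫ u : Fin d → ℝ, (∏ r, K (u r)) * φ (x + h • u) := by
  have e : ∀ y, prodKernel K h y x * φ y = 1 / h ^ d *
      (fun z : Fin d → ℝ => (fun u : Fin d → ℝ => (∏ r, K (u r)) * φ (x + h • u)) (h⁻¹ • z))
        (y - x) := fun y => by
    simp only [prodKernel, smul_inv_smul₀ hh.ne', add_sub_cancel, Pi.smul_apply, Pi.sub_apply,
      smul_eq_mul, div_eq_inv_mul]
    ring
  simp_rw [e]
  rw [integral_const_mul, integral_sub_right_eq_self (fun z : Fin d → ℝ =>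
    (fun u : Fin d → ℝ => (∏ r, K (u r)) * φ (x + h • u)) (h⁻¹ • z)) x,
    Measure.integral_comp_inv_smul_of_nonneg volume
      (fun u : Fin d → ℝ => (∏ r, K (u r)) * φ (x + h • u)) hh.le]
  rw [Module.finrank_fin_fun, smul_eq_mul, ← mul_assoc, one_div_mul_cancel (by positivity), one_mul]

end Kernel

/-! ### Integrals against the sampling law -/

section Density

variable {d : ℕ} {f₀ : Cube d → ℝ} {g : (Fin d → ℝ) → ℝ}

theorem measurableSet_cube (d : ℕ) : MeasurableSet (Set.Icc (0 : Fin d → ℝ) 1) :=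
  measurableSet_Icc

theorem isProbabilityMeasure_densityLaw (hg : Continuous g) (hg0 : ∀ x, 0 ≤ g x)
    (hg1 : ∫ x in Set.Icc (0 : Fin d → ℝ) 1, g x = 1) (hf : ∀ x : Cube d, f₀ x = g x) :
    IsProbabilityMeasure (densityLaw f₀) := by
  constructor
  unfold densityLaw
  rw [withDensity_apply _ MeasurableSet.univ, Measure.restrict_univ]
  simp_rw [hf]
  rw [lintegral_subtype_comap (measurableSet_cube d) (fun x => ENNReal.ofReal (g x)),
    ← ofReal_integral_eq_lintegral_ofReal (hg.continuousOn.integrableOn_compact isCompact_Icc)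
    (ae_of_all _ hg0), hg1, ENNReal.ofReal_one]

/-- As g vanishes off the cube, the integral extends to the whole space. Kernel smoothing near the
boundary therefore needs no correction. -/
theorem integral_densityLaw (hg : Measurable g) (hg0 : ∀ x, 0 ≤ g x)
    (hgs : Function.support g ⊆ Set.Icc 0 1) (hf : ∀ x : Cube d, f₀ x = g x)
    (φ : (Fin d → ℝ) → ℝ) :
    ∫ y : Cube d, φ y ∂densityLaw f₀ = ∫ y, φ y * g y := by
  unfold densityLaw
  simp_rw [hf]
  have hm : Measurable fun x : Cube d => ENNReal.ofReal (g x) :=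
    (hg.comp measurable_subtype_coe).ennreal_ofReal
  rw [integral_withDensity_eq_integral_toReal_smul hm (ae_of_all _ fun x => ENNReal.ofReal_lt_top)]
  simp_rw [ENNReal.toReal_ofReal (hg0 _), smul_eq_mul]
  rw [integral_subtype_comap (measurableSet_cube d) (fun x => g x * φ x),
    setIntegral_eq_integral_of_forall_compl_eq_zero]
  · simp_rw [mul_comm]
  · intro x hx
    have : g x = 0 := by
      by_contra hne
      exact hx (hgs hne)
    rw [this, zero_mul]

/-- One of the two Schur constants. After rescaling, the bound does not involve h, in contrast with
the sup bound of order h^{-d}. -/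
theorem integral_abs_prodKernel_densityLaw_le (hg : Measurable g) (hg0 : ∀ x, 0 ≤ g x) {F : ℝ}
    (hgF : ∀ x, g x ≤ F) (hgs : Function.support g ⊆ Set.Icc 0 1) (hf : ∀ x : Cube d, f₀ x = g x)
    {K : ℝ → ℝ} (hK : Integrable K) {h : ℝ} (hh : 0 < h) (x : Fin d → ℝ) :
    ∫ y : Cube d, |prodKernel K h (y : Fin d → ℝ) x| ∂densityLaw f₀ ≤ F * (∫ u, |K u|) ^ d := by
  rw [integral_densityLaw hg hg0 hgs hf (fun y => |prodKernel K h y x|)]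
  simp_rw [abs_prodKernel hh]
  rw [integral_prodKernel_mul hh]
  have hi : Integrable fun u : Fin d → ℝ => ∏ r, |K (u r)| :=
    Integrable.fintype_prod (f := fun _ : Fin d => fun u => |K u|) fun _ => hK.abs
  have h1 : ∫ u : Fin d → ℝ, F * ∏ r, |K (u r)| = F * (∫ u, |K u|) ^ d := by
    rw [integral_const_mul, integral_fintype_prod_volume_eq_pow (fun u => |K u|), Fintype.card_fin]
  rw [← h1]
  refine integral_mono_of_nonneg (ae_of_all _ fun u => ?_) (hi.const_mul F)
    (ae_of_all _ fun u => ?_)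
  · exact mul_nonneg (Finset.prod_nonneg fun r _ => abs_nonneg _) (hg0 _)
  · simp only
    rw [mul_comm]
    exact mul_le_mul_of_nonneg_right (hgF _) (Finset.prod_nonneg fun r _ => abs_nonneg _)

/-- The other Schur constant: exchanging the arguments reflects K, which preserves ∫ |K|. -/
theorem integral_abs_prodKernel_swap_densityLaw_le (hg : Measurable g) (hg0 : ∀ x, 0 ≤ g x) {F : ℝ}
    (hgF : ∀ x, g x ≤ F) (hgs : Function.support g ⊆ Set.Icc 0 1) (hf : ∀ x : Cube d, f₀ x = g x)
    {K : ℝ → ℝ} (hK : Integrable K) {h : ℝ} (hh : 0 < h) (y : Fin d → ℝ) :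
    ∫ x : Cube d, |prodKernel K h y (x : Fin d → ℝ)| ∂densityLaw f₀ ≤ F * (∫ u, |K u|) ^ d := by
  simp_rw [prodKernel_swap K h y]
  have := integral_abs_prodKernel_densityLaw_le hg hg0 hgF hgs hf hK.comp_neg hh y
  rwa [integral_neg_eq_self (fun u => |K u|)] at this

theorem integral_indicator_box_densityLaw_le [IsProbabilityMeasure (densityLaw f₀)]
    (hg : Measurable g) (hg0 : ∀ x, 0 ≤ g x) {F : ℝ}
    (hgF : ∀ x, g x ≤ F) (hgs : Function.support g ⊆ Set.Icc 0 1) (hf : ∀ x : Cube d, f₀ x = g x)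
    (c : Fin d → ℝ) {η : ℝ} (hη : 0 ≤ η) :
    ∫ y : Cube d, (Set.Icc (fun r => c r - η) (fun r => c r + η)).indicator (fun _ => (1 : ℝ))
      (y : Fin d → ℝ) ∂densityLaw f₀ ≤ F * (2 * η) ^ d := by
  rw [integral_densityLaw hg hg0 hgs hf]
  set S := Set.Icc (fun r => c r - η) (fun r => c r + η) with hS
  have hSm : MeasurableSet S := measurableSet_Icc
  have hvol : volume.real S = (2 * η) ^ d := by
    rw [hS, measureReal_def, Real.volume_Icc_pi_toReal (fun r => by linarith)]
    have : ∀ r, c r + η - (c r - η) = 2 * η := fun r => by ring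
    simp [this]
  have hfin : volume S ≠ ⊤ := isCompact_Icc.measure_lt_top.ne
  have h1 : ∫ y, S.indicator (fun _ => F) y = F * (2 * η) ^ d := by
    rw [integral_indicator_const _ hSm, hvol, smul_eq_mul, mul_comm]
  rw [← h1]
  refine integral_mono_of_nonneg (ae_of_all _ fun y => ?_)
    ((integrable_indicator_iff hSm).2 (integrableOn_const hfin)) (ae_of_all _ fun y => ?_)
  · exact mul_nonneg (Set.indicator_nonneg (fun _ _ => zero_le_one) _) (hg0 y)
  · by_cases hy : y ∈ S
    · simp [hy, hgF]
    · simp [hy]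

theorem abs_integral_prodKernel_sub_le (hg : Measurable g) (hg0 : ∀ x, 0 ≤ g x) {F : ℝ}
    (hgF : ∀ x, |g x| ≤ F) (hgs : Function.support g ⊆ Set.Icc 0 1)
    (hf : ∀ x : Cube d, f₀ x = g x) {K : ℝ → ℝ} {s : ℕ} (hK : IsKernelOfOrder K s)
    (hsupp : Function.support K ⊆ Set.Icc (-1) 1) {β h : ℝ} (hβ : 0 < β) (hF : 0 ≤ F) (hh : 0 < h)
    (hpoly : CoordPolyApprox s β F g) (x : Cube d) :
    |∫ y : Cube d, prodKernel K h (y : Fin d → ℝ) x ∂densityLaw f₀ - f₀ x| ≤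
      d * (∫ u, |K u|) ^ d * (F * h ^ β) := by
  rw [integral_densityLaw hg hg0 hgs hf (fun y => prodKernel K h y x), integral_prodKernel_mul hh,
    hf]
  exact abs_integral_prod_kernel_mul_sub_le hK hsupp hβ hF hh.le hg hgF hpoly x

end Density

/-! ### Chernoff bound for counts -/

section Tail

variable {Ω : Type*} [MeasurableSpace Ω]

/-- An upper tail bound for the number of sample points in a set. -/
theorem measureReal_lt_sum_indicator_le (μ : Measure Ω) [IsProbabilityMeasure μ] {S : Set Ω}
    (hS : MeasurableSet S) {p a : ℝ} (hp : ∫ x, S.indicator (fun _ => (1 : ℝ)) x ∂μ ≤ p) (n : ℕ) :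
    (Measure.pi fun _ : Fin n => μ).real {X | a < ∑ l, S.indicator (fun _ => (1 : ℝ)) (X l)} ≤
      Real.exp (2 * (n * p) - a) := by
  set ψ : Ω → ℝ := S.indicator fun _ => (1 : ℝ) with hψ
  have hψm : Measurable ψ := measurable_const.indicator hS
  have hψ2 : ∀ x, ψ x ^ 2 = ψ x := fun x => by
    by_cases hx : x ∈ S <;> simp [hψ, hx]
  have hψ1 : ∀ x, |ψ x| ≤ 1 := fun x => by
    by_cases hx : x ∈ S <;> simp [hψ, hx]
  -- Chernoff at t = 1. An indicator equals its square, so first and second moments together give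
  -- the factor 2 in the exponent.
  have h1 := integral_exp_sum_le μ hψm hψ1 (t := 1) (by simp) n
  simp only [one_mul, one_pow, hψ2] at h1
  have hm : Measurable fun X : Fin n → Ω => Real.exp (∑ l, ψ (X l)) :=
    Real.measurable_exp.comp (Finset.measurable_sum _ fun l _ => hψm.comp (measurable_pi_apply l))
  have hi : Integrable (fun X : Fin n → Ω => Real.exp (∑ l, ψ (X l)))
      (Measure.pi fun _ : Fin n => μ) := by
    refine integrable_of_abs_le hm (C := Real.exp n) fun X => ?_
    rw [abs_of_pos (Real.exp_pos _), Real.exp_le_exp]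
    refine (Finset.sum_le_sum fun l _ => le_of_abs_le (hψ1 (X l))).trans ?_
    simp
  have h2 := mul_meas_ge_le_integral_of_nonneg (ae_of_all _ fun X => (Real.exp_pos _).le) hi
    (Real.exp a)
  have h3 : (Measure.pi fun _ : Fin n => μ).real {X | a < ∑ l, ψ (X l)} ≤
      (Measure.pi fun _ : Fin n => μ).real {X | Real.exp a ≤ Real.exp (∑ l, ψ (X l))} :=
    measureReal_mono fun X hX => Real.exp_le_exp.2 (le_of_lt hX)
  have h4 : (n : ℝ) * (∫ x, ψ x ∂μ + ∫ x, ψ x ∂μ) ≤ 2 * (n * p) := by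
    nlinarith [(Nat.cast_nonneg n : (0 : ℝ) ≤ n)]
  rw [Real.exp_sub, le_div_iff₀' (Real.exp_pos a)]
  calc _ ≤ _ := mul_le_mul_of_nonneg_left h3 (Real.exp_pos a).le
    _ ≤ _ := h2
    _ ≤ _ := h1
    _ ≤ _ := Real.exp_le_exp.2 h4

end Tail

/-! ### Grid boxes, and translation of the definitions -/

section Main

variable {d : ℕ}

/-- The box of radius `2h` around the grid point `h • i`, as a subset of the cube. -/
def gridBox (h : ℝ) {m : ℕ} (i : Fin d → Fin (m + 1)) : Set (Cube d) :=
  Subtype.val ⁻¹' Set.Icc (fun r => h * i r - 2 * h) (fun r => h * i r + 2 * h)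

theorem measurableSet_gridBox (h : ℝ) {m : ℕ} (i : Fin d → Fin (m + 1)) :
    MeasurableSet (gridBox h i) := measurable_subtype_coe measurableSet_Icc

/-- The samples with at most `a` points in each grid box. -/
def sparseSamples (d n : ℕ) (h : ℝ) (m : ℕ) (a : ℝ) : Set (Fin n → Cube d) :=
  {X | ∀ i : Fin d → Fin (m + 1), ∑ l, (gridBox h i).indicator (fun _ => (1 : ℝ)) (X l) ≤ a}

theorem measurableSet_sparseSamples (d n : ℕ) (h : ℝ) (m : ℕ) (a : ℝ) :
    MeasurableSet (sparseSamples d n h m a) := by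
  have : sparseSamples d n h m a = ⋂ i : Fin d → Fin (m + 1),
      {X | ∑ l, (gridBox h i).indicator (fun _ => (1 : ℝ)) (X l) ≤ a} := by
    ext X; simp [sparseSamples]
  rw [this]
  refine MeasurableSet.iInter fun i => measurableSet_le (Finset.measurable_sum _ fun l _ => ?_)
    measurable_const
  exact (measurable_const.indicator (measurableSet_gridBox h i)).comp (measurable_pi_apply l)

/-- Reduces a supremum over all x to finitely many counts. The grid point below x is within h of x,
and a sample point that contributes at x is within h of x, hence in the box of radius 2h. As 1/h =
m, the grid indices stay at most m. -/
theorem abs_sampleMean_prodKernel_le {K : ℝ → ℝ} (hsupp : Function.support K ⊆ Set.Icc (-1) 1)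
    {M : ℝ} (hM : ∀ u, |K u| ≤ M) {h : ℝ} (hh : 0 < h) {m n : ℕ} (hm : h⁻¹ = m) {a : ℝ}
    {X : Fin n → Cube d} (hX : X ∈ sparseSamples d n h m a) (x : Cube d) :
    |sampleMean (fun y : Cube d => prodKernel K h (y : Fin d → ℝ) x) X| ≤
      1 / n * (1 / h ^ d * M ^ d * a) := by
  have hM0 : 0 ≤ M := (abs_nonneg _).trans (hM 0)
  have hxr : ∀ r, 0 ≤ (x : Fin d → ℝ) r / h := fun r => div_nonneg (x.2.1 r) hh.le
  have hfl : ∀ r, ⌊(x : Fin d → ℝ) r / h⌋₊ < m + 1 := fun r => by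
    refine Nat.lt_succ_of_le (Nat.floor_le_of_le ?_)
    rw [← hm, div_eq_mul_inv]
    exact mul_le_of_le_one_left (by positivity) (x.2.2 r)
  set i : Fin d → Fin (m + 1) := fun r => ⟨⌊(x : Fin d → ℝ) r / h⌋₊, hfl r⟩ with hi
  have hpt : ∀ y : Cube d, |prodKernel K h (y : Fin d → ℝ) x| ≤
      1 / h ^ d * M ^ d * (gridBox h i).indicator (fun _ => (1 : ℝ)) y := fun y => by
    by_cases hy : y ∈ gridBox h i
    · rw [Set.indicator_of_mem hy, mul_one]
      exact abs_prodKernel_le hM hh _ _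
    · rw [Set.indicator_of_notMem hy, mul_zero]
      have : ∃ r, h < |(y : Fin d → ℝ) r - (x : Fin d → ℝ) r| := by
        by_contra! hall
        refine hy ⟨fun r => ?_, fun r => ?_⟩
        all_goals
          have h1 := abs_le.1 (hall r)
          have h2 := Nat.floor_le (hxr r)
          have h3 := Nat.lt_floor_add_one ((x : Fin d → ℝ) r / h)
          rw [le_div_iff₀ hh] at h2
          rw [div_lt_iff₀ hh] at h3
          simp only [hi]
          nlinarith
      obtain ⟨r, hr⟩ := this
      rw [prodKernel_eq_zero hsupp hh hr, abs_zero]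
  refine (abs_sampleMean_le_sampleMean_abs _ _).trans ((sampleMean_mono hpt X).trans ?_)
  rw [sampleMean_const_mul]
  unfold sampleMean
  have := hX i
  calc _ = 1 / n * (1 / h ^ d * M ^ d *
        ∑ l, (gridBox h i).indicator (fun _ => (1 : ℝ)) (X l)) := by ring
    _ ≤ _ := by gcongr

theorem measureReal_compl_sparseSamples_le {f₀ : Cube d → ℝ} {g : (Fin d → ℝ) → ℝ}
    [IsProbabilityMeasure (densityLaw f₀)]
    (hg : Measurable g) (hg0 : ∀ x, 0 ≤ g x) {F : ℝ} (hgF : ∀ x, g x ≤ F)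
    (hgs : Function.support g ⊆ Set.Icc 0 1) (hf : ∀ x : Cube d, f₀ x = g x)
    (n : ℕ) {h : ℝ} (hh : 0 < h) (m : ℕ) (a : ℝ) :
    (Measure.pi fun _ : Fin n => densityLaw f₀).real (sparseSamples d n h m a)ᶜ ≤
      (m + 1) ^ d * Real.exp (2 * (n * (F * (4 * h) ^ d)) - a) := by
  have hsub : (sparseSamples d n h m a)ᶜ ⊆ ⋃ i : Fin d → Fin (m + 1),
      {X | a < ∑ l, (gridBox h i).indicator (fun _ => (1 : ℝ)) (X l)} := fun X hX => by
    simpa [sparseSamples] using hX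
  refine (measureReal_mono hsub).trans ((measureReal_iUnion_fintype_le _).trans ?_)
  have hbox : ∀ i : Fin d → Fin (m + 1),
      ∫ y, (gridBox h i).indicator (fun _ => (1 : ℝ)) y ∂densityLaw f₀ ≤
        F * (4 * h) ^ d := fun i => by
    have h1 := integral_indicator_box_densityLaw_le hg hg0 hgF hgs hf (fun r => h * i r)
      (η := 2 * h) (by positivity)
    rw [show 2 * (2 * h) = 4 * h by ring] at h1
    exact h1
  refine (Finset.sum_le_sum fun i _ =>
    measureReal_lt_sum_indicator_le _ (measurableSet_gridBox h i) (hbox i) n).trans ?_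
  simp

theorem loss_regData {n : ℕ} (K : ℝ → ℝ) (h : ℝ) (D : Data d n) (f : Cube d → ℝ) :
    loss (regData K h D) f = sampleMean (fun x : Cube d => (sampleMean
      (fun y : Cube d => prodKernel K h (y : Fin d → ℝ) x) D.2 - f x) ^ 2) D.1 := by
  unfold loss regData kde sampleMean prodKernel
  congr 1
  refine Finset.sum_congr rfl fun i _ => ?_
  congr 2
  simp only
  rw [← Finset.mul_sum, ← mul_assoc]
  congr 1
  rw [one_div_mul_one_div]

theorem measurable_regData {n : ℕ} {K : ℝ → ℝ} (hK : Measurable K) (h : ℝ) :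
    Measurable fun D : Data d n => regData K h D := by
  unfold regData kde
  refine measurable_pi_lambda _ fun i => ?_
  refine ((measurable_pi_apply i).comp measurable_fst).prodMk (measurable_const.mul
    (Finset.measurable_sum _ fun l _ => Finset.measurable_prod _ fun r _ => hK.comp ?_))
  refine Measurable.div_const (Measurable.sub ?_ ?_) h
  · exact (measurable_pi_apply r).comp (measurable_subtype_coe.comp
      ((measurable_pi_apply l).comp measurable_snd))
  · exact (measurable_pi_apply r).comp (measurable_subtype_coe.comp
      ((measurable_pi_apply i).comp measurable_fst))

/-- Compares with the optimization error, whose infimum over the class need not be measurable: g is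
used only through monotonicity of the lower integral. The upper bound C keeps that integral finite,
so `toReal` does not collapse to 0. -/
theorem integral_le_toReal_lintegral {α : Type*} [MeasurableSpace α] {μ : Measure α}
    [IsFiniteMeasure μ] {f g : α → ℝ} (hf : Integrable f μ) (hfg : ∀ x, f x ≤ g x) {C : ℝ}
    (hg : ∀ x, g x ≤ C) : ∫ x, f x ∂μ ≤ (∫⁻ x, ENNReal.ofReal (g x) ∂μ).toReal := by
  rw [integral_eq_lintegral_pos_part_sub_lintegral_neg_part hf]
  refine (sub_le_self _ ENNReal.toReal_nonneg).trans (ENNReal.toReal_mono ?_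
    (lintegral_mono fun x => ENNReal.ofReal_le_ofReal (hfg x)))
  refine ((lintegral_mono fun x => ENNReal.ofReal_le_ofReal (hg x)).trans_lt ?_).ne
  rw [lintegral_const]
  exact ENNReal.mul_lt_top ENNReal.ofReal_lt_top (measure_lt_top _ _)

theorem exists_finite_net {𝓕 : Set (Cube d → ℝ)} {δ : NNReal} (hN : supCoveringNumber 𝓕 δ ≠ ⊤) :
    ∃ C : Finset (UniformFun (Cube d) ℝ), (∀ f ∈ C, UniformFun.toFun f ∈ 𝓕) ∧
      (C.card = (supCoveringNumber 𝓕 δ).toNat) ∧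
      ∀ f ∈ 𝓕, ∃ f' ∈ C, ∀ x, |f x - UniformFun.toFun f' x| ≤ δ := by
  obtain ⟨C, hCsub, hfin, hcov, hcard⟩ := Metric.exists_set_encard_eq_coveringNumber hN
  refine ⟨hfin.toFinset, fun f hf => hCsub (hfin.mem_toFinset.1 hf), ?_, fun f hf => ?_⟩
  · unfold supCoveringNumber
    rw [← hcard, hfin.encard_eq_coe_toFinset_card]
    rfl
  · obtain ⟨f', hf', hd⟩ := hcov (show UniformFun.ofFun f ∈ UniformFun.toFun ⁻¹' 𝓕 from hf)
    refine ⟨f', hfin.mem_toFinset.2 hf', fun x => ?_⟩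
    have h1 : edist (UniformFun.ofFun f) f' ≤ δ := hd
    rw [UniformFun.edist_def] at h1
    have h2 : edist (f x) (UniformFun.toFun f' x) ≤ δ := (le_iSup (fun x =>
      edist (UniformFun.toFun (UniformFun.ofFun f) x) (UniformFun.toFun f' x)) x).trans h1
    rw [edist_le_coe] at h2
    rw [← Real.dist_eq]
    exact h2

end Main

/-! ### Consequences of the bandwidth condition -/

section Bandwidth

theorem one_le_log_of_three_le {n : ℕ} (hn : 3 ≤ n) : 1 ≤ Real.log n := by
  have hn3 : (3 : ℝ) ≤ n := by exact_mod_cast hn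
  rw [Real.le_log_iff_exp_le (by linarith)]
  linarith [Real.exp_one_lt_d9]

theorem IsBandwidth.pos {d n : ℕ} {h : ℝ} (hh : IsBandwidth d n h) : 0 < h := by
  obtain ⟨m, hm, e⟩ := hh.inv_eq_natCast
  have : 0 < h⁻¹ := by rw [e]; exact_mod_cast hm
  exact inv_pos.1 this

theorem rpow_one_div_pow {d : ℕ} (hd : 1 ≤ d) {a : ℝ} (ha : 0 ≤ a) :
    (a ^ (1 / (d : ℝ))) ^ d = a := by
  rw [one_div]
  exact Real.rpow_inv_natCast_pow ha (by omega)

theorem IsBandwidth.le_pow {d n : ℕ} (hd : 1 ≤ d) {h : ℝ} (hh : IsBandwidth d n h) :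
    Real.log n / n ≤ h ^ d := by
  have h0 : 0 ≤ Real.log n / n := div_nonneg (Real.log_natCast_nonneg n) (Nat.cast_nonneg n)
  calc Real.log n / n = ((Real.log n / n) ^ (1 / (d : ℝ))) ^ d := (rpow_one_div_pow hd h0).symm
    _ ≤ h ^ d := pow_le_pow_left₀ (Real.rpow_nonneg h0 _) hh.lower d

theorem IsBandwidth.pow_le {d n : ℕ} (hd : 1 ≤ d) {h : ℝ} (hh : IsBandwidth d n h) :
    h ^ d ≤ 2 ^ d * (Real.log n / n) := by
  have h0 : 0 ≤ Real.log n / n := div_nonneg (Real.log_natCast_nonneg n) (Nat.cast_nonneg n)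
  calc h ^ d ≤ (2 * (Real.log n / n) ^ (1 / (d : ℝ))) ^ d :=
        pow_le_pow_left₀ hh.pos.le hh.upper d
    _ = _ := by rw [mul_pow, rpow_one_div_pow hd h0]

theorem IsBandwidth.rpow_sq_le {d n : ℕ} {h β : ℝ} (hβ : 0 < β) (hh : IsBandwidth d n h) :
    (h ^ β) ^ 2 ≤ (2 ^ β) ^ 2 * (Real.log n / n) ^ (2 * β / d) := by
  have h0 : 0 ≤ Real.log n / n := div_nonneg (Real.log_natCast_nonneg n) (Nat.cast_nonneg n)
  have h1 : h ^ β ≤ 2 ^ β * ((Real.log n / n) ^ (1 / (d : ℝ))) ^ β := by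
    rw [← Real.mul_rpow zero_le_two (Real.rpow_nonneg h0 _)]
    exact Real.rpow_le_rpow hh.pos.le hh.upper hβ.le
  calc (h ^ β) ^ 2 ≤ (2 ^ β * ((Real.log n / n) ^ (1 / (d : ℝ))) ^ β) ^ 2 :=
        pow_le_pow_left₀ (Real.rpow_nonneg hh.pos.le _) h1 2
    _ = _ := by
        rw [mul_pow, ← Real.rpow_mul h0, ← Real.rpow_natCast ((Real.log n / n) ^ _),
          ← Real.rpow_mul h0]
        congr 2
        push_cast
        ring

end Bandwidth

/-! ### Assembly -/

section Main

/-- The oracle inequality with the comparison function, the bias and the tail event explicit. -/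
theorem risk_le_of_net {d n : ℕ} (hd : 1 ≤ d) (hn : 3 ≤ n) {β F : ℝ} (hβ : 0 < β) (hF1 : 1 ≤ F)
    {K : ℝ → ℝ} (hK : IsKernelOfOrder K (floorLt β)) {M : ℝ} (hM : ∀ u, |K u| ≤ M)
    (hsupp : Function.support K ⊆ Set.Icc (-1) 1) {h : ℝ} (hh : IsBandwidth d n h)
    {f₀ : Cube d → ℝ} {g : (Fin d → ℝ) → ℝ} (hg : Continuous g) (hg0 : ∀ x, 0 ≤ g x)
    (hgF : ∀ x, |g x| ≤ F) (hgs : Function.support g ⊆ Set.Icc 0 1)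
    (hg1 : ∫ x in Set.Icc (0 : Fin d → ℝ) 1, g x = 1) (hf : ∀ x : Cube d, f₀ x = g x)
    (hpoly : CoordPolyApprox (floorLt β) β F g)
    {𝓕 : Set (Cube d → ℝ)} (h𝓕 : ∀ f ∈ 𝓕, Measurable f ∧ ∀ x, |f x| ≤ F)
    {fhat : (Fin n → Cube d × ℝ) → Cube d → ℝ}
    (hfm : Measurable (fun p : (Fin n → Cube d × ℝ) × Cube d => fhat p.1 p.2))
    (hfF : ∀ Z, fhat Z ∈ 𝓕) {δ : NNReal} (hN : supCoveringNumber 𝓕 δ ≠ ⊤)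
    {A B L : ℝ} (hA : A = F * (∫ u, |K u|) ^ d) (hB : B = M ^ d * (2 * F * 8 ^ d + 3))
    (hL : L = 36 * (2 * B + 4 * F + 2 * A) ^ 2) {v : Cube d → ℝ} (hv : v ∈ 𝓕) :
    1 ≤ ((supCoveringNumber 𝓕 δ).toNat : ℝ) ∧ risk K h fhat f₀ ≤ 6 * optError K h 𝓕 fhat f₀ +
      7 * ∫ x, (v x - f₀ x) ^ 2 ∂densityLaw f₀ + δ * (28 * F + 12 * (A + F)) +
      48 * (d * (∫ u, |K u|) ^ d * (F * h ^ β)) ^ 2 +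
      L / n * (Real.log ((supCoveringNumber 𝓕 δ).toNat : ℝ) + 1) +
      (28 * F ^ 2 + 24 * F * M ^ d) * 2 ^ d / n := by
  have hprob := isProbabilityMeasure_densityLaw hg hg0 hg1 hf
  have hgF' : ∀ x, g x ≤ F := fun x => le_of_abs_le (hgF x)
  have hF0 : 0 ≤ F := by linarith
  have hh0 := hh.pos
  have hM0 : 0 ≤ M := (abs_nonneg _).trans (hM 0)
  have hn0 : (0 : ℝ) < n := by exact_mod_cast (by omega : 0 < n)
  have hn1 : (1 : ℝ) ≤ n := by exact_mod_cast (by omega : 1 ≤ n)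
  have hlog := one_le_log_of_three_le hn
  have hC1 := one_le_integral_abs_kernel hK
  have hA0 : 0 < A := by rw [hA]; positivity
  have hB0 : 0 ≤ B := by rw [hB]; positivity
  obtain ⟨m, hm0, hm⟩ := hh.inv_eq_natCast
  have hhd0 : 0 < h ^ d := by positivity
  have hhd : 1 / h ^ d ≤ n / Real.log n := by
    rw [one_div_le hhd0 (by positivity), one_div_div]
    exact hh.le_pow hd
  have hhd' : 1 / h ^ d ≤ n := hhd.trans (div_le_self hn0.le hlog)
  -- The first summand cancels the Chernoff exponent 2nF(4h)^d ≤ 2F 8^d log n; the second leaves a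
  -- tail n^{-3} per box. In `hGB` the factor log n cancels against 1/(n h^d) ≤ 1/log n, so B does
  -- not depend on n.
  set a := (2 * F * 8 ^ d + 3) * Real.log n with ha
  set G := sparseSamples d n h m a with hG
  have hGB : ∀ X' ∈ G, ∀ x : Cube d,
      |sampleMean (fun y : Cube d => prodKernel K h (y : Fin d → ℝ) x) X'| ≤ B := fun X' hX' x => by
    refine (abs_sampleMean_prodKernel_le hsupp hM hh0 hm hX' x).trans ?_
    have h1 : 1 / (n : ℝ) * (1 / h ^ d * M ^ d * a) ≤ 1 / n * (n / Real.log n * M ^ d * a) := by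
      gcongr
    refine h1.trans (le_of_eq ?_)
    rw [ha, hB]
    field_simp
  -- Union bound: at most 2^d n boxes, each failing with probability at most n^{-3}.
  have hGc : (Measure.pi fun _ : Fin n => densityLaw f₀).real Gᶜ ≤ 2 ^ d / (n : ℝ) ^ 2 := by
    refine (measureReal_compl_sparseSamples_le hg.measurable hg0 hgF' hgs hf n hh0 m a).trans ?_
    have h1 : ((m : ℝ) + 1) ^ d ≤ 2 ^ d * n := by
      have hm1 : (1 : ℝ) ≤ m := by exact_mod_cast hm0
      calc ((m : ℝ) + 1) ^ d ≤ (2 * m) ^ d := pow_le_pow_left₀ (by positivity) (by linarith) d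
        _ = 2 ^ d * (1 / h ^ d) := by rw [mul_pow, ← hm, inv_pow, one_div]
        _ ≤ 2 ^ d * n := by gcongr
    have h2 : 2 * (n * (F * (4 * h) ^ d)) - a ≤ -(3 * Real.log n) := by
      have h3 : (n : ℝ) * (4 * h) ^ d ≤ 8 ^ d * Real.log n := by
        calc (n : ℝ) * (4 * h) ^ d = 4 ^ d * (n * h ^ d) := by rw [mul_pow]; ring
          _ ≤ 4 ^ d * (n * (2 ^ d * (Real.log n / n))) := by
            gcongr
            exact hh.pow_le hd
          _ = (4 * 2) ^ d * Real.log n := by rw [mul_pow]; field_simp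
          _ = _ := by norm_num
      have h4 := mul_le_mul_of_nonneg_left h3 (by positivity : 0 ≤ 2 * F)
      rw [ha]
      linarith
    have h5 : Real.exp (-(3 * Real.log n)) = 1 / (n : ℝ) ^ 3 := by
      rw [Real.exp_neg, one_div, show 3 * Real.log n = ((3 : ℕ) : ℝ) * Real.log n by norm_num,
        Real.exp_nat_mul, Real.exp_log hn0]
    calc _ ≤ 2 ^ d * n * (1 / (n : ℝ) ^ 3) := by
          refine mul_le_mul h1 ?_ (Real.exp_pos _).le (by positivity)
          rw [← h5]
          exact Real.exp_le_exp.2 h2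
      _ = _ := by field_simp
  obtain ⟨C, hC𝓕, hCcard, hCcov⟩ := exists_finite_net hN
  have hCne : Nonempty C := by
    obtain ⟨f', hf', -⟩ := hCcov v hv
    exact ⟨⟨f', hf'⟩⟩
  have hkm : Measurable (Function.uncurry fun y x : Cube d => prodKernel K h (y : Fin d → ℝ) x) :=
    (measurable_prodKernel hK.measurable h d).comp
      ((measurable_subtype_coe.comp measurable_fst).prodMk
        (measurable_subtype_coe.comp measurable_snd))
  have hum : Measurable (Function.uncurry fun (D : Data d n) x => fhat (regData K h D) x) :=
    hfm.comp (((measurable_regData hK.measurable h).comp measurable_fst).prodMk measurable_snd)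
  have hf₀F : ∀ x, |f₀ x| ≤ F := fun x => by rw [hf]; exact hgF x
  have hf₀m : Measurable f₀ := by
    rw [show f₀ = fun x : Cube d => g x from funext hf]
    exact hg.measurable.comp measurable_subtype_coe
  have hL1 : 12 * (2 * B + 4 * F) * F ≤ L := by
    rw [hL]; nlinarith [mul_nonneg hB0 hA0.le, mul_nonneg hF0 hA0.le, mul_nonneg hB0 hF0]
  have hL2 : 24 * F * A ≤ L := by
    rw [hL]; nlinarith [mul_nonneg hB0 hA0.le, mul_nonneg hF0 hA0.le, mul_nonneg hB0 hF0]
  have hL3 : 36 * (2 * B + 4 * F) ^ 2 + 144 * A ^ 2 ≤ 2 * L := by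
    rw [hL]; nlinarith [mul_nonneg hB0 hA0.le, mul_nonneg hF0 hA0.le, mul_nonneg hB0 hF0]
  have hL0 : 0 < L := by rw [hL]; positivity
  have hmain := integral_risk_le (μ := densityLaw f₀) (by omega : 0 < n) hkm
    (fun y x => abs_prodKernel_le hM hh0 _ _) hA0
    (fun x => (integral_abs_prodKernel_densityLaw_le hg.measurable hg0 hgF' hgs hf hK.integrable
      hh0 x).trans hA.ge)
    (fun y => (integral_abs_prodKernel_swap_densityLaw_le hg.measurable hg0 hgF' hgs hf
      hK.integrable hh0 y).trans hA.ge) hf₀m hf₀F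
    (abs_integral_prodKernel_sub_le hg.measurable hg0 hgF hgs hf hK hsupp hβ hF0 hh0 hpoly)
    (measurableSet_sparseSamples d n h m a) hGB hL0 hL1 hL2 hL3 hum
    (fun D x => (h𝓕 _ (hfF _)).2 x) (f := fun j : C => UniformFun.toFun j.1)
    (fun j => (h𝓕 _ (hC𝓕 _ j.2)).1) (fun j x => (h𝓕 _ (hC𝓕 _ j.2)).2 x) δ.coe_nonneg
    (fun D => by
      obtain ⟨f', hf', hd'⟩ := hCcov _ (hfF (regData K h D))
      exact ⟨⟨f', hf'⟩, hd'⟩) (h𝓕 v hv).1 (h𝓕 v hv).2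
  have hcard : Fintype.card C = (supCoveringNumber 𝓕 δ).toNat := by
    rw [Fintype.card_coe, hCcard]
  rw [hcard] at hmain
  refine ⟨by rw [← hcard]; exact_mod_cast Fintype.card_pos, ?_⟩
  have hrisk : risk K h fhat f₀ = ∫ D : Data d n, ∫ x, (fhat (regData K h D) x - f₀ x) ^ 2
      ∂densityLaw f₀
      ∂(Measure.pi fun _ => densityLaw f₀).prod (Measure.pi fun _ => densityLaw f₀) := by
    unfold risk dataLaw
    refine integral_prod _ (integrable_sq_of_abs_le (c := 2 * F) ?_ fun p => ?_)
    · exact hum.sub (hf₀m.comp measurable_snd)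
    · exact abs_sub_le_two_mul ((h𝓕 _ (hfF _)).2 _) (hf₀F _)
  have hκ : ∀ y x : Cube d, |prodKernel K h (y : Fin d → ℝ) x| ≤ 1 / h ^ d * M ^ d :=
    fun y x => abs_prodKernel_le hM hh0 _ _
  have hlu := integrable_sampleMean_sq_sub (μ := densityLaw f₀) (n := n)
    (w := fun (D : Data d n) x => fhat (regData K h D) x) hkm hκ hum
    (fun D x => (h𝓕 _ (hfF _)).2 x)
  have hlv := integrable_sampleMean_sq_sub (μ := densityLaw f₀) (n := n) (w := fun _ => v) hkm hκ
    ((h𝓕 v hv).1.comp measurable_snd) (fun _ => (h𝓕 v hv).2)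
  have hloss0 : ∀ (D : Data d n) (f : Cube d → ℝ), 0 ≤ loss (regData K h D) f := fun D f =>
    mul_nonneg (by positivity) (Finset.sum_nonneg fun i _ => sq_nonneg _)
  have hopt : ∫ D : Data d n, (sampleMean (fun x : Cube d => (sampleMean
        (fun y : Cube d => prodKernel K h (y : Fin d → ℝ) x) D.2 -
          fhat (regData K h D) x) ^ 2) D.1 -
      sampleMean (fun x : Cube d => (sampleMean
        (fun y : Cube d => prodKernel K h (y : Fin d → ℝ) x) D.2 - v x) ^ 2) D.1)
      ∂(Measure.pi fun _ => densityLaw f₀).prod (Measure.pi fun _ => densityLaw f₀) ≤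
      optError K h 𝓕 fhat f₀ := by
    refine integral_le_toReal_lintegral (hlu.sub hlv) (C := (1 / h ^ d * M ^ d + F) ^ 2)
      (g := fun D => loss (regData K h D) (fhat (regData K h D)) -
        ⨅ f : 𝓕, loss (regData K h D) f.1) (fun D => ?_) (fun D => ?_)
    · have h1 : ⨅ f : 𝓕, loss (regData K h D) f.1 ≤ loss (regData K h D) v :=
        ciInf_le ⟨0, by rintro _ ⟨f, rfl⟩; exact hloss0 D f⟩ (⟨v, hv⟩ : 𝓕)
      rw [loss_regData K h D v] at h1
      simp only [loss_regData K h D (fhat (regData K h D))]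
      linarith
    · have h1 : 0 ≤ ⨅ f : 𝓕, loss (regData K h D) f.1 := Real.iInf_nonneg fun f => hloss0 D f
      have h2 : loss (regData K h D) (fhat (regData K h D)) ≤ (1 / h ^ d * M ^ d + F) ^ 2 := by
        rw [loss_regData]
        refine le_of_abs_le (abs_sampleMean_le (by positivity) (fun x =>
          abs_sq_le_sq_of_abs_le ((abs_sub _ _).trans (add_le_add ?_ ((h𝓕 _ (hfF _)).2 x)))) D.1)
        exact abs_sampleMean_le (by positivity) (fun y => hκ y x) D.2
      linarith
  -- Off G the kernel is only bounded by M^d / h^d ≤ n M^d; against the probability 2^d / n² this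
  -- still leaves O(1/n).
  have htail : (4 * F ^ 2 + 24 * F * (1 / h ^ d * M ^ d + F)) *
      (Measure.pi fun _ : Fin n => densityLaw f₀).real Gᶜ ≤
      (28 * F ^ 2 + 24 * F * M ^ d) * 2 ^ d / n := by
    have h1 : 4 * F ^ 2 + 24 * F * (1 / h ^ d * M ^ d + F) ≤ (28 * F ^ 2 + 24 * F * M ^ d) * n := by
      have h2 : 1 / h ^ d * M ^ d ≤ n * M ^ d := by gcongr
      have h3 := mul_le_mul_of_nonneg_left h2 (by positivity : 0 ≤ 24 * F)
      have h4 := mul_le_mul_of_nonneg_left hn1 (by positivity : 0 ≤ 28 * F ^ 2)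
      linarith
    calc _ ≤ (28 * F ^ 2 + 24 * F * M ^ d) * n * (2 ^ d / (n : ℝ) ^ 2) :=
          mul_le_mul h1 hGc measureReal_nonneg (by positivity)
      _ = _ := by field_simp
  rw [hrisk]
  refine hmain.trans ?_
  linarith

end Main

end TwoStage

theorem theorem1 (d : ℕ) (hd : 1 ≤ d) (β : ℝ) (hβ : 0 < β) (Q F : ℝ) (hF : max Q 1 ≤ F)
    (K : ℝ → ℝ) (hK : TwoStage.IsKernelOfOrder K (TwoStage.floorLt β))
    (hKbdd : ∃ M : ℝ, ∀ u, |K u| ≤ M) (hKsupp : Function.support K ⊆ Set.Icc (-1) 1) :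
    ∃ C₁ C₂ C₃ : ℝ, ∀ (n : ℕ), 3 ≤ n → ∀ (h : ℝ), TwoStage.IsBandwidth d n h →
      ∀ f₀ ∈ TwoStage.HolderDensityCube d β Q,
      ∀ 𝓕 : Set (TwoStage.Cube d → ℝ), (∀ f ∈ 𝓕, Measurable f ∧ ∀ x, |f x| ≤ F) →
      ∀ fhat : (Fin n → TwoStage.Cube d × ℝ) → TwoStage.Cube d → ℝ,
        Measurable (fun p : (Fin n → TwoStage.Cube d × ℝ) × TwoStage.Cube d => fhat p.1 p.2) →
        (∀ Z, fhat Z ∈ 𝓕) →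
      ∀ δ : NNReal, 0 < δ → TwoStage.supCoveringNumber 𝓕 δ ≠ ⊤ →
        TwoStage.risk K h fhat f₀ ≤
          C₁ * (Real.log n ^ 2 *
              Real.log (max (n : ℝ) ((TwoStage.supCoveringNumber 𝓕 δ).toNat : ℝ)) / n)
            + C₂ * δ + C₃ * (Real.log n / n) ^ (2 * β / d)
            + 6 * TwoStage.optError K h 𝓕 fhat f₀
            + 7 * ⨅ f : 𝓕, ∫ x, (f.1 x - f₀ x) ^ 2 ∂TwoStage.densityLaw f₀ := by
  obtain ⟨M, hM⟩ := hKbdd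
  have hM0 : 0 ≤ M := (abs_nonneg _).trans (hM 0)
  have hF1 : 1 ≤ F := (le_max_right _ _).trans hF
  have hF0 : 0 ≤ F := by linarith
  set C : ℝ := ∫ u, |K u| with hC
  set A : ℝ := F * C ^ d with hA
  set B : ℝ := M ^ d * (2 * F * 8 ^ d + 3) with hB
  set L : ℝ := 36 * (2 * B + 4 * F + 2 * A) ^ 2 with hL
  set T : ℝ := (28 * F ^ 2 + 24 * F * M ^ d) * 2 ^ d with hT
  refine ⟨2 * L + T, 28 * F + 12 * (A + F), 48 * (d * C ^ d * F) ^ 2 * (2 ^ β) ^ 2, ?_⟩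
  rintro n hn h hh f₀ ⟨g, ⟨⟨hgc, hgn⟩, hgs, hg1, hg0⟩, hf⟩ 𝓕 h𝓕 fhat hfm hfF δ - hN
  -- Enlarging Q to F gives one constant for the Hölder norm, the density and the class.
  have hg : g ∈ TwoStage.HolderBall d β F :=
    ⟨hgc, hgn.trans (ENNReal.ofReal_le_ofReal ((le_max_left _ _).trans hF))⟩
  have hpoly := TwoStage.coordPolyApprox_of_mem_holderBall hβ hF0 hg
  have hmain := fun (v : TwoStage.Cube d → ℝ) (hv : v ∈ 𝓕) =>
    TwoStage.risk_le_of_net hd hn hβ hF1 hK hM hKsupp hh hgc.continuous hg0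
      (TwoStage.abs_le_of_holderNorm_le hF0 hg.2) hgs hg1 hf hpoly h𝓕 hfm hfF hN
      (hA : A = _) (hB : B = _) (hL : L = _) hv
  obtain ⟨x₀⟩ : Nonempty (TwoStage.Cube d) := ⟨⟨0, le_rfl, zero_le_one⟩⟩
  -- The class contains the values of the estimator, here at an arbitrary data set; nonemptiness is
  -- needed for the infimum.
  have hne : Nonempty 𝓕 := ⟨⟨_, hfF fun _ => (x₀, 0)⟩⟩
  have hN1 := (hmain _ (hfF fun _ => (x₀, 0))).1
  have hn0 : (0 : ℝ) < n := by exact_mod_cast (by omega : 0 < n)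
  have hlog := TwoStage.one_le_log_of_three_le hn
  set N : ℝ := ((TwoStage.supCoveringNumber 𝓕 δ).toNat : ℝ) with hNdef
  set ℓ := Real.log (max (n : ℝ) N) with hℓ
  have hℓ1 : 1 ≤ ℓ := hlog.trans (Real.log_le_log hn0 (le_max_left _ _))
  have hℓN : Real.log N ≤ ℓ := Real.log_le_log (by linarith) (le_max_right _ _)
  -- The only place where log² n enters; it is pure slack, since log n ≥ 1 for n ≥ 3.
  have hℓ2 : ℓ ≤ Real.log n ^ 2 * ℓ := le_mul_of_one_le_left (by linarith) (one_le_pow₀ hlog)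
  have hL0 : 0 ≤ L := by positivity
  have hT0 : 0 ≤ T := by positivity
  have hstoch : L / n * (Real.log N + 1) + T / n ≤ (2 * L + T) * (Real.log n ^ 2 * ℓ / n) := by
    have h1 : L * (Real.log N + 1) + T ≤ (2 * L + T) * (Real.log n ^ 2 * ℓ) := by
      nlinarith [mul_le_mul_of_nonneg_left (by linarith : Real.log N + 1 ≤ 2 * ℓ) hL0,
        mul_le_mul_of_nonneg_left hℓ2 (by linarith : 0 ≤ 2 * L + T),
        mul_le_mul_of_nonneg_left hℓ1 hT0]
    have h2 := div_le_div_of_nonneg_right h1 hn0.le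
    calc L / n * (Real.log N + 1) + T / n = (L * (Real.log N + 1) + T) / n := by ring
      _ ≤ _ := h2
      _ = _ := by ring
  have hbias : 48 * (d * C ^ d * (F * h ^ β)) ^ 2 ≤
      48 * (d * C ^ d * F) ^ 2 * (2 ^ β) ^ 2 * (Real.log n / n) ^ (2 * β / d) := by
    have h1 := mul_le_mul_of_nonneg_left (hh.rpow_sq_le hβ)
      (by positivity : 0 ≤ 48 * (d * C ^ d * F) ^ 2)
    calc _ = 48 * (d * C ^ d * F) ^ 2 * (h ^ β) ^ 2 := by ring
      _ ≤ _ := h1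
      _ = _ := by ring
  set R := L / n * (Real.log N + 1) + T / n + (28 * F + 12 * (A + F)) * δ +
    48 * (d * C ^ d * (F * h ^ β)) ^ 2 + 6 * TwoStage.optError K h 𝓕 fhat f₀ with hR
  -- Everything in R is independent of v, so the bound for each v passes to the infimum.
  have hinf : (TwoStage.risk K h fhat f₀ - R) / 7 ≤
      ⨅ f : 𝓕, ∫ x, (f.1 x - f₀ x) ^ 2 ∂TwoStage.densityLaw f₀ := by
    refine le_ciInf fun f => ?_
    have h1 := (hmain f.1 f.2).2
    rw [div_le_iff₀ (by norm_num), hR]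
    linarith
  linarith
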